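/- Let $\alpha>0$ and let $X=\{X_t\}_{t\in T}$ be an $\alpha$-Fréchet process, i.e. every finite maximum $\bigvee_j a_jX_{t_j}$ with $a_j>0$ has distribution function $\exp(-\sigma^\alpha x^{-\alpha})$, $x>0$, for some $\sigma>0$. For a measure space $(S,\mu)$ let $L^\alpha_+(S,\mu)$ be the set of measurable $f:S\to[0,\infty)$ with $\int f^\alpha d\mu<\infty$, with $\|f\|=(\int f^\alpha d\mu)^{1/\alpha}$ and metric $\rho(f,g)=\int|f^\alpha-g^\alpha|\,d\mu$. A family $\{f_t\}_{t\in T}\subset L^\alpha_+(S,\mu)$ is a spectral representation of $X$ if the finite-dimensional distributions of $X$ are those of the extremal integrals $\int^e_S f_t\,dM_\alpha$ with respect to an $\alpha$-Fréchet random sup-measure $M_\alpha$ with control measure $\mu$. (Such an $M_\alpha$ is a family of random variables $M_\alpha(A)\in[0,\infty]$, $A\subset S$ measurable, independent for finitely many disjoint sets, with $\mathbb P(M_\alpha(A)\le x)=\exp(-\mu(A)x^{-\alpha})$ for $x>0$, and $M_\alpha(\bigcup_iA_i)=\sup_iM_\alpha(A_i)$ a.s. for disjoint $A_1,A_2,\dots$;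 one sets $\int^e\sum_i a_i\mathbf 1_{A_i}dM_\alpha=\bigvee_ia_iM_\alpha(A_i)$ for simple functions with disjoint $A_i$, and extends this to $L^\alpha_+(S,\mu)$ by $\rho$-approximation and convergence in probability.) Write $\overline{\vee\text{-span}}\{f_t\}$ for the $\rho$-closure of the set of all $\bigvee_{i\le n}a_if_{t_i}$, $n\ge1$, $a_i>0$, and let $\mathrm{supp}\{f_t\}$ be the set (defined modulo $\mu$) $\{f_0\ne0\}$, where $f_0\in\overline{\vee\text{-span}}\{f_t\}$ is such that $\mu(\{f\neq 0\}\setminus\{f_0\ne0\})=0$ for all $f$ in this span. The representation is minimal if $\mathrm{supp}\{f_t\}=S$ $\mu$-a.e. and every measurable $B\subset S$ agrees modulo $\mu$ with a set in the $\sigma$-field generated by all ratios $f_t/f_{t'}$ (with values in $[0,\infty]$, $0/0=0$). A max-linear isometry $U$ between subsets of such spaces is a map with $U(a_1f_1\vee a_2f_2)=a_1Uf_1\vee a_2Uf_2$ a.e. for $a_1,a_2\ge0$, and $\|Uf\|=\|f\|$. For $I\in\{0,1\}$ and $N\in\{0,1,\dots,\infty\}$ let $S_{I,N}$ be the union of $\{n\in\mathbb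 N:1\le n\le N\}$ and, if $I=1$, the interval $(0,1)$; let $\lambda_{I,N}$ be Lebesgue measure on the part in $(0,1)$ plus counting measure on the integer part. Theorem. Let $\{f_t\}\subset L^\alpha_+(S_{I,N},\lambda_{I,N})$ be a minimal spectral representation of $X$, and let $\{g_t\}\subset L^\alpha_+(S,\mu)$ be an arbitrary spectral representation of $X$, where $S$ is a standard Borel space and $\mu$ is $\sigma$-finite. There is an a.e.-unique max-linear isometry $U:\overline{\vee\text{-span}}\{f_t\}\to\overline{\vee\text{-span}}\{g_t\}$ with $Uf_t=g_t$ $\mu$-a.e. for all $t$ (the relating isometry), $\mathrm{supp}\{g_t\}$ exists, and: (i) $U$ extends to a max-linear isometry $L^\alpha_+(S_{I,N},\lambda_{I,N})\to L^\alpha_+(S,\mu)$, which is unique up to $\mu$-a.e. equality of the images; it is again denoted by $U$. (ii) Let $A$ be any measurable version of $\mathrm{supp}\{g_t\}$. There are measurable $\Phi:S\to S_{I,N}$ and $h:S\to(0,\infty)$ such that $\Phi$ maps $A$ onto $S_{I,N}$, $$g_t=Uf_t=\mathbf 1_A\,h\,(f_t\circ\Phi)\quad\mu\text{-a.e., for all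 }t\in T,\qquad \lambda_{I,N}=\mu_h\circ\Phi^{-1},\quad d\mu_h=\mathbf 1_A\,h^\alpha\,d\mu,$$ and $Uf=\mathbf 1_A\,h\,(f\circ\Phi)$ $\mu$-a.e. for every $f\in L^\alpha_+(S_{I,N},\lambda_{I,N})$. The map $\Phi$ is unique modulo $\mu$ on $A$: if measurable $\Phi':S\to S_{I,N}$ and $h':S\to(0,\infty)$ also satisfy the two displayed relations (that is, $g_t=\mathbf 1_A h'(f_t\circ\Phi')$ and $\lambda_{I,N}=(\mathbf 1_A h'^\alpha\mu)\circ\Phi'^{-1}$), then $\Phi'=\Phi$ $\mu$-a.e. on $A$. In particular, if $\{g_t\}$ has full support one may take $A=S$, and the factor $\mathbf 1_A$ disappears. -/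

import Mathlib

open MeasureTheory ProbabilityTheory Set Filter Topology
open scoped NNReal ENNReal

noncomputable section

namespace MaxStable

/-! ### The standardized spaces `(S_{I,N}, λ_{I,N})` -/

/-- `S_{I,N} ⊆ (0,1) ∪ {1, 2, …}`: the interval `(0,1)` is present iff `I = 1`, and the integer part
is `{n : 1 ≤ n ≤ N}` with `N ∈ {0, 1, 2, …, ∞}`. -/
def stdSupport (I : Fin 2) (N : ℕ∞) : Set ℝ :=
  {x | (I = 1 ∧ x ∈ Ioo (0 : ℝ) 1) ∨ ∃ n : ℕ, 1 ≤ n ∧ (n : ℕ∞) ≤ N ∧ x = n}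

theorem measurableSet_stdSupport (I : Fin 2) (N : ℕ∞) : MeasurableSet (stdSupport I N) := by
  have h : {x : ℝ | ∃ n : ℕ, 1 ≤ n ∧ (n : ℕ∞) ≤ N ∧ x = n}.Countable :=
    (countable_range ((↑) : ℕ → ℝ)).mono (by rintro x ⟨n, -, -, rfl⟩; exact ⟨n, rfl⟩)
  exact ((MeasurableSet.const _).inter measurableSet_Ioo).union h.measurableSet

/-- `λ_{I,N}`: Lebesgue measure on the part of `S_{I,N}` in `(0,1)`, counting measure on the
integer part. -/
def stdMeasure (I : Fin 2) (N : ℕ∞) : Measure (stdSupport I N) :=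
  Measure.comap Subtype.val
    ((volume : Measure ℝ).restrict (Ioo 0 1) +
      (Measure.count : Measure ℝ).restrict (range ((↑) : ℕ → ℝ)))

/-! ### The spaces `L^α_+(S, μ)` -/

section Spaces

variable {S : Type*} [MeasurableSpace S]

/-- `L^α_+(S, μ)`: measurable `f : S → [0,∞)` with `∫ f^α dμ < ∞`. Members are functions;
identities between them are stated `μ`-a.e. -/
def Lplus (α : ℝ) (μ : Measure S) : Set (S → ℝ≥0) :=
  {f | Measurable f ∧ ∫⁻ s, (f s : ℝ≥0∞) ^ α ∂μ < ∞}

/-- `‖f‖ = (∫ f^α dμ)^{1/α}`. -/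
def normPlus (α : ℝ) (μ : Measure S) (f : S → ℝ≥0) : ℝ≥0∞ :=
  (∫⁻ s, (f s : ℝ≥0∞) ^ α ∂μ) ^ (1 / α)

/-- `ρ_{μ,α}(f, g) = ∫ |f^α - g^α| dμ`. -/
def rhoDist (α : ℝ) (μ : Measure S) (f g : S → ℝ≥0) : ℝ≥0∞ :=
  ∫⁻ s, edist (f s ^ α) (g s ^ α) ∂μ

variable {T : Type*}

/-- The positive max-linear combinations `⋁ a_i f_{t_i}` (finitely many, at least one term,
`a_i > 0`). -/
def maxSpan (f : T → S → ℝ≥0) : Set (S → ℝ≥0) :=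
  {φ | ∃ J : Finset T, J.Nonempty ∧ ∃ a : T → ℝ≥0, (∀ t ∈ J, 0 < a t) ∧
    φ = fun s => J.sup fun t => a t * f t s}

/-- The closure of `maxSpan f` in `L^α_+(S, μ)` for the metric `ρ_{μ,α}`. -/
def closedMaxSpan (α : ℝ) (μ : Measure S) (f : T → S → ℝ≥0) : Set (S → ℝ≥0) :=
  {φ | φ ∈ Lplus α μ ∧ ∀ ε : ℝ≥0∞, 0 < ε → ∃ ψ ∈ maxSpan f, rhoDist α μ ψ φ < ε}

/-- `f₀` has full support with respect to `F`. -/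
def HasFullSupport (μ : Measure S) (F : Set (S → ℝ≥0)) (f₀ : S → ℝ≥0) : Prop :=
  ∀ g ∈ F, μ ({s | g s ≠ 0} \ {s | f₀ s ≠ 0}) = 0

/-- `A = supp{f_t : t ∈ T}` modulo `μ`, i.e. `A` is `μ`-a.e. the set `{f₀ ≠ 0}` for some `f₀` in the
closed max-linear span of the `f_t` having full support with respect to that span. -/
def IsSupport (α : ℝ) (μ : Measure S) (f : T → S → ℝ≥0) (A : Set S) : Prop :=
  ∃ f₀ ∈ closedMaxSpan α μ f, HasFullSupport μ (closedMaxSpan α μ f) f₀ ∧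
    {s | f₀ s ≠ 0} =ᵐ[μ] A

/-- The ratio `σ`-field generated by all `f_{t₁} / f_{t₂}`, with values in `[0,∞]`
(and `0 / 0 = 0`). -/
@[reducible] def ratioSigma (f : T → S → ℝ≥0) : MeasurableSpace S :=
  ⨆ (t₁ : T) (t₂ : T),
    MeasurableSpace.comap (fun s => (f t₁ s : ℝ≥0∞) / (f t₂ s : ℝ≥0∞)) inferInstance

/-- Minimality of a family of spectral functions. -/
structure IsMinimal (α : ℝ) (μ : Measure S) (f : T → S → ℝ≥0) : Prop where
  support : IsSupport α μ f univ
  ratio : ∀ B : Set S, MeasurableSet B →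
    ∃ A : Set S, MeasurableSet[ratioSigma f] A ∧ μ (symmDiff A B) = 0

end Spaces

/-! ### Fréchet processes, random sup-measures, extremal integrals -/

section RandomMeasures

variable {S : Type*} [MeasurableSpace S] {Ω : Type*} [MeasurableSpace Ω] {T : Type*}

/-- `Z` is `α`-Fréchet: `P(Z ≤ x) = exp(-σ^α x^{-α})`, `x > 0`, for some scale `σ > 0`. -/
def IsFrechet (α : ℝ) (P : Measure Ω) (Z : Ω → ℝ) : Prop :=
  ∃ σ : ℝ, 0 < σ ∧ ∀ x : ℝ, 0 < x →
    P {ω | Z ω ≤ x} = ENNReal.ofReal (Real.exp (-(σ ^ α * x ^ (-α))))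

/-- `X` is an `α`-Fréchet process: all positive max-linear combinations of the `X_t` are
`α`-Fréchet. -/
def IsFrechetProcess (α : ℝ) (P : Measure Ω) (X : T → Ω → ℝ) : Prop :=
  (∀ t, Measurable (X t)) ∧
  ∀ (J : Finset T) (hJ : J.Nonempty) (a : T → ℝ), (∀ t ∈ J, 0 < a t) →
    IsFrechet α P fun ω => J.sup' hJ fun t => a t * X t ω

/-- `M` is an `α`-Fréchet random sup-measure with control measure `μ`. The variable `M(A)` takes
values in `[0,∞]`, so that sets of infinite measure are allowed; it has scale `μ(A)^{1/α}`, meaning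
that it is `0` a.s. if `μ(A) = 0` and `∞` a.s. if `μ(A) = ∞`. -/
structure IsFrechetSupMeasure (α : ℝ) (μ : Measure S) (P : Measure Ω)
    (M : Set S → Ω → ℝ≥0∞) : Prop where
  measurable : ∀ A, MeasurableSet A → Measurable (M A)
  indep : ∀ (n : ℕ) (A : Fin n → Set S), (∀ i, MeasurableSet (A i)) →
    Pairwise (fun i j => Disjoint (A i) (A j)) → iIndepFun (fun i => M (A i)) P
  law_of_lt_top : ∀ A, MeasurableSet A → μ A < ∞ → ∀ x : ℝ, 0 < x →
    P {ω | M A ω ≤ ENNReal.ofReal x} =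
      ENNReal.ofReal (Real.exp (-((μ A).toReal * x ^ (-α))))
  law_of_eq_top : ∀ A, MeasurableSet A → μ A = ∞ → ∀ x : ℝ, 0 < x →
    P {ω | M A ω ≤ ENNReal.ofReal x} = 0
  iUnion : ∀ A : ℕ → Set S, (∀ i, MeasurableSet (A i)) →
    Pairwise (fun i j => Disjoint (A i) (A j)) →
    ∀ᵐ ω ∂P, M (⋃ i, A i) ω = ⨆ i, M (A i) ω

/-- The extremal integral `⋁ a_i M(A_i)` of the simple function with value `a_i` on `A_i`. -/
def simpleExtremalIntegral (M : Set S → Ω → ℝ≥0∞) (φ : SimpleFunc S ℝ≥0) (ω : Ω) : ℝ≥0∞ :=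
  φ.range.sup fun a => (a : ℝ≥0∞) * M (φ ⁻¹' {a}) ω

/-- `ξ` is the extremal integral of `f`: the limit in probability of the extremal integrals of simple
functions converging to `f` in `L^α_+(S, μ)`. -/
def IsExtremalIntegral (α : ℝ) (μ : Measure S) (P : Measure Ω) (M : Set S → Ω → ℝ≥0∞)
    (f : S → ℝ≥0) (ξ : Ω → ℝ≥0∞) : Prop :=
  ∃ φ : ℕ → SimpleFunc S ℝ≥0, (∀ n, ⇑(φ n) ∈ Lplus α μ) ∧
    Tendsto (fun n => rhoDist α μ (φ n) f) atTop (𝓝 0) ∧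
    TendstoInMeasure P (fun n => simpleExtremalIntegral M (φ n)) atTop ξ

/-- `{f_t} ⊆ L^α_+(S, μ)` is a spectral representation of `X`: for some `α`-Fréchet random
sup-measure with control measure `μ`, the process of the extremal integrals of the `f_t` has the
finite-dimensional distributions of `X`. -/
def IsSpectralRep (α : ℝ) (P : Measure Ω) (X : T → Ω → ℝ) (μ : Measure S)
    (f : T → S → ℝ≥0) : Prop :=
  (∀ t, f t ∈ Lplus α μ) ∧
  ∃ (Ω' : Type) (_ : MeasurableSpace Ω') (P' : Measure Ω') (M : Set S → Ω' → ℝ≥0∞)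
    (ξ : T → Ω' → ℝ≥0∞),
    IsProbabilityMeasure P' ∧ IsFrechetSupMeasure α μ P' M ∧
    (∀ t, IsExtremalIntegral α μ P' M (f t) (ξ t)) ∧
    ∀ J : Finset T, IdentDistrib (fun ω (t : J) => X t ω)
      (fun ω' (t : J) => (ξ t ω').toReal) P P'

end RandomMeasures

/-! ### Max-linear isometries and point representations -/

section Isometries

variable {S₁ S₂ : Type*} [MeasurableSpace S₁] [MeasurableSpace S₂] {T : Type*}

/-- `U` is a max-linear isometry from `F ⊆ L^α_+(S₁, μ₁)` to `G ⊆ L^α_+(S₂, μ₂)`. -/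
structure IsMaxLinearIsometry (α : ℝ) (μ₁ : Measure S₁) (μ₂ : Measure S₂)
    (F : Set (S₁ → ℝ≥0)) (G : Set (S₂ → ℝ≥0)) (U : (S₁ → ℝ≥0) → S₂ → ℝ≥0) : Prop where
  mapsTo : MapsTo U F G
  maxLinear : ∀ f₁ ∈ F, ∀ f₂ ∈ F, ∀ a₁ a₂ : ℝ≥0,
    U (fun s => max (a₁ * f₁ s) (a₂ * f₂ s)) =ᵐ[μ₂] fun s => max (a₁ * U f₁ s) (a₂ * U f₂ s)
  norm_eq : ∀ f ∈ F, normPlus α μ₂ (U f) = normPlus α μ₁ f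

/-- `U` is the relating max-linear isometry of `{f_t}` and `{g_t}`: it maps the closed max-linear
span of the `f_t` to that of the `g_t`, with `U f_t = g_t`. -/
structure IsRelatingIsometry (α : ℝ) (μ₁ : Measure S₁) (μ₂ : Measure S₂)
    (f : T → S₁ → ℝ≥0) (g : T → S₂ → ℝ≥0) (U : (S₁ → ℝ≥0) → S₂ → ℝ≥0) : Prop
    extends IsMaxLinearIsometry α μ₁ μ₂ (closedMaxSpan α μ₁ f) (closedMaxSpan α μ₂ g) U where
  map_eq : ∀ t, U (f t) =ᵐ[μ₂] g t

/-- `V` is an extension of `U`, defined on the closed max-linear span of the `f_t`, to a max-linear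
isometry on all of `L^α_+(S₁, μ₁)`. -/
structure IsIsometryExtension (α : ℝ) (μ₁ : Measure S₁) (μ₂ : Measure S₂)
    (f : T → S₁ → ℝ≥0) (U V : (S₁ → ℝ≥0) → S₂ → ℝ≥0) : Prop
    extends IsMaxLinearIsometry α μ₁ μ₂ (Lplus α μ₁) (Lplus α μ₂) V where
  extends_eq : ∀ φ ∈ closedMaxSpan α μ₁ f, V φ =ᵐ[μ₂] U φ

/-- Measurable `Φ : S₂ → S₁` and `h : S₂ → (0,∞)` represent the `g_t` through the `f_t` on the set
`A` (the support of the `g_t`): `g_t = h (f_t ∘ Φ)` a.e. on `A` and `g_t = 0` a.e. off `A`, and `μ₁`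
is the image under `Φ` of the measure `h^α dμ₂` on `A`. -/
structure IsPointRep (α : ℝ) (μ₁ : Measure S₁) (μ₂ : Measure S₂) (f : T → S₁ → ℝ≥0)
    (g : T → S₂ → ℝ≥0) (A : Set S₂) (Φ : S₂ → S₁) (h : S₂ → ℝ≥0) : Prop where
  measurable_map : Measurable Φ
  measurable_factor : Measurable h
  factor_pos : ∀ s, 0 < h s
  eq_comp : ∀ t, g t =ᵐ[μ₂] A.indicator fun s => h s * f t (Φ s)
  measure_eq : μ₁ = ((μ₂.restrict A).withDensity fun s => (h s : ℝ≥0∞) ^ α).map Φ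

end Isometries

end MaxStable

end

/-! A spectral representation enters only through the norms of its max-linear combinations: `P(a_t
X_t ≤ 1 for all t ∈ J) = exp(-‖⋁ a_t f_t‖^α)` (`IsSpectralRep.law`). Two representations of `X`
therefore satisfy `SameNorms`, and from there on the argument is pure measure theory.

Put `F_t = f_t^α`. Differentiating `∫ ⋁ b_j F_j dμ` in one coefficient gives the mass of `F_k dμ` on
`{⋁ b_j F_j < F_k}`. Such sets determine the law of the ratios `(F_j / F_k)_j` under `F_k dμ`, so
both representations have the same ratio laws. Hence `∫ H((f_t)_t) dμ` is the same for both whenever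
`H ≥ 0` is measurable, homogeneous of degree `α` and zero where a fixed sequence of coordinates
vanishes (`SameNorms.lintegral_eq`).

Minimality supplies a decoder: a scale-invariant `Θ` with `Θ((f_t(s))_t) = s` a.e., read off from
the ratios, and a homogeneous `L` that does not vanish on `(f_t(s))_t`, by full support. Set `Φ =
Θ(g)`, `h = L(g) / L(f ∘ Φ)` and `A = {L(g) ≠ 0}`. The relation `g_t = h (f_t ∘ Φ)` on `A` is a
scale-invariant condition on the vector `(g_t)_t` that holds trivially for `(f_t)_t`; integrating
`L^α` over the set where it fails carries it over to `g`. The formula for the image measure comes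
from another choice of `H`.

The isometry is then `φ ↦ 1_A h (φ ∘ Φ)`. For its uniqueness, adjoin `φ` to the `f_t` and `U φ` to
the `g_t`: the norms still agree and the old decoder still works, so `U φ` is forced
(`IsDecoder.ae_eq_transport_of_consFamily`). The map `Φ` is forced because `Θ(h (f ∘ Φ')) = Θ(f ∘
Φ') = Φ'`. Exact surjectivity is obtained by changing `Φ` on a null set. -/

noncomputable section

namespace MaxStable

/-! ### Norms of max-linear combinations determine integrals of homogeneous functionals. -/

section Homogeneous

variable {S₁ S₂ K : Type*} [MeasurableSpace S₁] [MeasurableSpace S₂]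

/-- All finite max-linear combinations of the `F k` and of the `G k` have equal integrals. -/
def EqualMaxIntegrals (μ₁ : Measure S₁) (μ₂ : Measure S₂) (F : K → S₁ → ℝ≥0)
    (G : K → S₂ → ℝ≥0) : Prop :=
  ∀ (J : Finset K) (a : K → ℝ≥0),
    ∫⁻ s, ((J.sup fun k => a k * F k s : ℝ≥0) : ℝ≥0∞) ∂μ₁ =
      ∫⁻ s, ((J.sup fun k => a k * G k s : ℝ≥0) : ℝ≥0∞) ∂μ₂

/-- The index `k` may already belong to `J`, so the extra term is merged into a single coefficient
per index by taking maxima. -/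
theorem EqualMaxIntegrals.max_sup {μ₁ : Measure S₁} {μ₂ : Measure S₂} {F : K → S₁ → ℝ≥0}
    {G : K → S₂ → ℝ≥0} (h : EqualMaxIntegrals μ₁ μ₂ F G) (J : Finset K) (k : K) (a : ℝ≥0)
    (b : K → ℝ≥0) :
    ∫⁻ s, ((max (a * F k s) (J.sup fun j => b j * F j s) : ℝ≥0) : ℝ≥0∞) ∂μ₁ =
      ∫⁻ s, ((max (a * G k s) (J.sup fun j => b j * G j s) : ℝ≥0) : ℝ≥0∞) ∂μ₂ := by
  classical
  have key : ∀ x : K → ℝ≥0, max (a * x k) (J.sup fun j => b j * x j) =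
      (insert k J).sup fun j =>
        max (if j = k then a else 0) (if j ∈ J then b j else 0) * x j := by
    intro x
    apply le_antisymm
    · refine max_le ?_ (Finset.sup_le fun j hj => ?_)
      · refine le_trans ?_ (Finset.le_sup (f := fun j =>
          max (if j = k then a else 0) (if j ∈ J then b j else 0) * x j)
          (Finset.mem_insert_self k J))
        simp only [if_true]
        gcongr
        exact le_max_left _ _
      · refine le_trans ?_ (Finset.le_sup (f := fun j =>
          max (if j = k then a else 0) (if j ∈ J then b j else 0) * x j)
          (Finset.mem_insert_of_mem hj))
        simp only [hj, if_true]
        gcongr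
        exact le_max_right _ _
    · refine Finset.sup_le fun j _ => ?_
      rw [max_mul]
      refine max_le ?_ ?_
      · split_ifs with hjk
        · subst hjk; exact le_max_left _ _
        · simp
      · split_ifs with hj
        · exact (Finset.le_sup (f := fun j => b j * x j) hj).trans (le_max_right _ _)
        · simp
  have h1 := h (insert k J) fun j => max (if j = k then a else 0) (if j ∈ J then b j else 0)
  have hF := fun s => key fun j => F j s
  have hG := fun s => key fun j => G j s
  simp only [hF, hG]
  exact h1

/-- This is the left derivative of `c ↦ ∫ max(c x, m) dμ` at `c = 1`, as difference quotients with
step `1/(n+1)`, cleared of denominators. The integrand is `0` where `x ≤ m`, is eventually `x` where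
`m < x`, and is dominated by `x`. -/
theorem tendsto_lintegral_max_sub {μ : Measure S₁} {x m : S₁ → ℝ≥0} (hx : Measurable x)
    (hm : Measurable m) (hfin : ∫⁻ s, (x s : ℝ≥0∞) ∂μ ≠ ∞) (hmfin : ∫⁻ s, (m s : ℝ≥0∞) ∂μ ≠ ∞) :
    Tendsto (fun n : ℕ => ∫⁻ s, ((max ((n + 1 : ℕ) * x s) ((n + 1 : ℕ) * m s) : ℝ≥0) : ℝ≥0∞) ∂μ -
      ∫⁻ s, ((max ((n : ℕ) * x s) ((n + 1 : ℕ) * m s) : ℝ≥0) : ℝ≥0∞) ∂μ) atTop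
      (𝓝 (∫⁻ s, ({s | m s < x s}.indicator (fun s => (x s : ℝ≥0∞)) s) ∂μ)) := by
  have hsub : ∀ n : ℕ, ∫⁻ s, ((max ((n + 1 : ℕ) * x s) ((n + 1 : ℕ) * m s) : ℝ≥0) : ℝ≥0∞) ∂μ -
      ∫⁻ s, ((max ((n : ℕ) * x s) ((n + 1 : ℕ) * m s) : ℝ≥0) : ℝ≥0∞) ∂μ =
      ∫⁻ s, (((max ((n + 1 : ℕ) * x s) ((n + 1 : ℕ) * m s) : ℝ≥0) : ℝ≥0∞) -
        ((max ((n : ℕ) * x s) ((n + 1 : ℕ) * m s) : ℝ≥0) : ℝ≥0∞)) ∂μ := by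
    intro n
    refine (lintegral_sub (by fun_prop) ?_ (Eventually.of_forall fun s => ?_)).symm
    · refine ne_of_lt (lt_of_le_of_lt (b := ∫⁻ s, ((n : ℝ≥0∞) * x s + (n + 1 : ℕ) * m s) ∂μ)
        (lintegral_mono fun s => ?_) ?_)
      · simp
      · rw [lintegral_add_left (by fun_prop), lintegral_const_mul _ (by fun_prop),
          lintegral_const_mul _ (by fun_prop)]
        exact ENNReal.add_lt_top.2 ⟨ENNReal.mul_lt_top (by simp) hfin.lt_top,
          ENNReal.mul_lt_top (by simp) hmfin.lt_top⟩
    · norm_cast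
      gcongr
      omega
  simp only [hsub]
  refine tendsto_lintegral_of_dominated_convergence (fun s => (x s : ℝ≥0∞)) (fun n => by fun_prop)
    (fun n => Eventually.of_forall fun s => ?_) hfin (Eventually.of_forall fun s => ?_)
  · rw [tsub_le_iff_right]
    rw [← ENNReal.coe_add, ENNReal.coe_le_coe]
    refine max_le ?_ ?_
    · calc ((n + 1 : ℕ) : ℝ≥0) * x s = x s + n * x s := by push_cast; ring
        _ ≤ _ := by gcongr; exact le_max_left _ _
    · exact (le_max_right _ _).trans le_add_self
  · by_cases h : m s < x s
    · refine tendsto_const_nhds.congr' ?_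
      -- From `n ≥ m / (x - m)` on, `(n+1) m ≤ n x`, so both maxima are attained by the `x` terms.
      obtain ⟨k, hk⟩ := exists_nat_gt (m s / (x s - m s))
      filter_upwards [eventually_ge_atTop k] with n hn
      have h2 : ((n + 1 : ℕ) : ℝ≥0) * m s ≤ n * x s := by
        have h0 : 0 < x s - m s := tsub_pos_of_lt h
        have : m s / (x s - m s) ≤ n := hk.le.trans (by exact_mod_cast hn)
        rw [div_le_iff₀ h0, mul_tsub] at this
        have h3 : (n : ℝ≥0) * m s ≤ n * x s := by gcongr
        calc ((n + 1 : ℕ) : ℝ≥0) * m s = m s + n * m s := by push_cast; ring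
          _ ≤ (n * x s - n * m s) + n * m s := by gcongr
          _ = n * x s := tsub_add_cancel_of_le h3
      rw [max_eq_left (by gcongr), max_eq_left h2, indicator_of_mem (by exact h)]
      norm_cast
      rw [← tsub_mul]
      simp
    · rw [indicator_of_notMem (by exact h)]
      refine tendsto_const_nhds.congr fun n => ?_
      push Not at h
      rw [max_eq_right (by gcongr), max_eq_right (by gcongr; norm_num), tsub_self]

theorem lintegral_sup_ne_top {μ : Measure S₁} {F : K → S₁ → ℝ≥0} (hF : ∀ k, Measurable (F k))
    (hfin : ∀ k, ∫⁻ s, (F k s : ℝ≥0∞) ∂μ ≠ ∞) (J : Finset K) (b : K → ℝ≥0) :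
    ∫⁻ s, ((J.sup fun j => b j * F j s : ℝ≥0) : ℝ≥0∞) ∂μ ≠ ∞ := by
  refine ne_of_lt (lt_of_le_of_lt (b := ∑ j ∈ J, ∫⁻ s, (b j : ℝ≥0∞) * F j s ∂μ) ?_ ?_)
  · rw [← lintegral_finsetSum _ (fun j _ => by have := hF j; fun_prop)]
    refine lintegral_mono fun s => ?_
    have : (J.sup fun j => b j * F j s) ≤ ∑ j ∈ J, b j * F j s :=
      Finset.sup_le fun j hj =>
        Finset.single_le_sum (f := fun j => b j * F j s) (fun _ _ => zero_le) hj
    simpa using ENNReal.coe_le_coe.2 this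
  · refine ENNReal.sum_lt_top.2 fun j _ => ?_
    rw [lintegral_const_mul _ (by have := hF j; fun_prop)]
    exact ENNReal.mul_lt_top (by simp) (hfin j).lt_top

theorem measurable_finset_sup_mul {F : K → S₁ → ℝ≥0} (hF : ∀ k, Measurable (F k)) (J : Finset K)
    (b : K → ℝ≥0) : Measurable fun s => J.sup fun j => b j * F j s := by
  induction J using Finset.cons_induction with
  | empty => simp
  | cons k J hk ih =>
    simp only [Finset.sup_cons]
    exact ((hF k).const_mul _).sup ih

theorem EqualMaxIntegrals.lintegral_indicator_eq {μ₁ : Measure S₁} {μ₂ : Measure S₂}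
    {F : K → S₁ → ℝ≥0} {G : K → S₂ → ℝ≥0} (h : EqualMaxIntegrals μ₁ μ₂ F G)
    (hF : ∀ k, Measurable (F k)) (hG : ∀ k, Measurable (G k))
    (hFfin : ∀ k, ∫⁻ s, (F k s : ℝ≥0∞) ∂μ₁ ≠ ∞) (hGfin : ∀ k, ∫⁻ s, (G k s : ℝ≥0∞) ∂μ₂ ≠ ∞)
    (J : Finset K) (k : K) (b : K → ℝ≥0) :
    ∫⁻ s, ({s | (J.sup fun j => b j * F j s) < F k s}.indicator
        (fun s => (F k s : ℝ≥0∞)) s) ∂μ₁ =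
      ∫⁻ s, ({s | (J.sup fun j => b j * G j s) < G k s}.indicator
        (fun s => (G k s : ℝ≥0∞)) s) ∂μ₂ := by
  have h1 := tendsto_lintegral_max_sub (hF k) (measurable_finset_sup_mul hF J b) (hFfin k)
    (lintegral_sup_ne_top hF hFfin J b)
  have h2 := tendsto_lintegral_max_sub (hG k) (measurable_finset_sup_mul hG J b) (hGfin k)
    (lintegral_sup_ne_top hG hGfin J b)
  refine tendsto_nhds_unique (h1.congr fun n => ?_) h2
  have key : ∀ (c : ℝ≥0) (x : K → ℝ≥0), (c * J.sup fun j => b j * x j) =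
      J.sup fun j => (c * b j) * x j := by
    intro c x
    rw [NNReal.mul_finset_sup]
    simp only [mul_assoc]
  simp only [key _ fun j => F j _, key _ fun j => G j _]
  rw [h.max_sup, h.max_sup]

/-- The law of `(F_j / F_k)_j` under `F_k dμ`. -/
def ratioLaw (μ : Measure S₁) (F : K → S₁ → ℝ≥0) (k : K) : Measure (K → ℝ≥0) :=
  (μ.withDensity fun s => (F k s : ℝ≥0∞)).map fun s j => F j s / F k s

theorem ratioLaw_apply (ν : Measure S₁) {E : K → S₁ → ℝ≥0} (hE : ∀ k, Measurable (E k)) (k : K)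
    {B : Set (K → ℝ≥0)} (hB : MeasurableSet B) : ratioLaw ν E k B =
      ∫⁻ s, ((fun s j => E j s / E k s) ⁻¹' B).indicator (fun s => (E k s : ℝ≥0∞)) s ∂ν := by
  have hm : Measurable fun s j => E j s / E k s :=
    measurable_pi_lambda _ fun j => (hE j).div (hE k)
  rw [ratioLaw, Measure.map_apply hm hB, withDensity_apply _ (hm hB),
    lintegral_indicator (hm hB)]

/-- Homogeneity factors `H(E) = E_k H(E / E_k)` where `E_k ≠ 0`; elsewhere both sides vanish by
`h0`. -/
theorem lintegral_ratioLaw (ν : Measure S₁) {E : K → S₁ → ℝ≥0} (hE : ∀ k, Measurable (E k))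
    {H : (K → ℝ≥0) → ℝ≥0∞} (hH : Measurable H)
    (hom : ∀ (r : ℝ≥0) x, 0 < r → H (r • x) = r * H x) (k : K) (h0 : ∀ x, x k = 0 → H x = 0) :
    ∫⁻ s, H (fun j => E j s) ∂ν = ∫⁻ x, H x ∂ratioLaw ν E k := by
  have hm : Measurable fun s j => E j s / E k s :=
    measurable_pi_lambda _ fun j => (hE j).div (hE k)
  rw [ratioLaw, lintegral_map hH hm]
  rw [lintegral_withDensity_eq_lintegral_mul _ (hE k).coe_nnreal_ennreal
    (show Measurable fun s => H fun j => E j s / E k s from hH.comp hm)]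
  refine lintegral_congr fun s => ?_
  by_cases hs : E k s = 0
  · simp [hs, h0 (fun j => E j s) hs]
  · rw [Pi.mul_apply, ← hom _ _ (pos_iff_ne_zero.2 hs)]
    congr 1
    ext j
    simp [mul_div_cancel₀ _ hs]

/-- Links the ratio laws to the derivative: a box of ratios is a comparison of `E_k` with a
max-linear combination. Points with `E_k = 0` carry no weight, so the value of a ratio with zero
denominator is immaterial. -/
theorem indicator_ratio_box {S : Type*} (E : K → S → ℝ≥0) (k : K) (J : Finset K) (c : K → ℝ≥0)
    (hc : ∀ j ∈ J, 0 < c j) :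
    ((fun s j => E j s / E k s) ⁻¹' (⋂ j ∈ J, {x | x j < c j})).indicator
      (fun s => (E k s : ℝ≥0∞)) = {s | (J.sup fun j => (c j)⁻¹ * E j s) < E k s}.indicator
        (fun s => (E k s : ℝ≥0∞)) := by
  ext s
  by_cases h0 : E k s = 0
  · simp [h0]
  · refine indicator_eq_indicator ?_ rfl
    rw [mem_preimage, mem_iInter₂, mem_ofPred_eq, Finset.sup_lt_iff (pos_iff_ne_zero.2 h0)]
    refine forall₂_congr fun j hj => ?_
    rw [mem_ofPred_eq, div_lt_iff₀ (pos_iff_ne_zero.2 h0), inv_mul_lt_iff₀ (hc j hj)]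

/-- Finite measures are compared on the π-system of finite-dimensional boxes `{x_j < c_j}`, which
generates the product σ-field. Boxes with some `c_j = 0` are empty. -/
theorem EqualMaxIntegrals.ratioLaw_eq {μ₁ : Measure S₁} {μ₂ : Measure S₂}
    {F : K → S₁ → ℝ≥0} {G : K → S₂ → ℝ≥0} (h : EqualMaxIntegrals μ₁ μ₂ F G)
    (hF : ∀ k, Measurable (F k)) (hG : ∀ k, Measurable (G k))
    (hFfin : ∀ k, ∫⁻ s, (F k s : ℝ≥0∞) ∂μ₁ ≠ ∞) (hGfin : ∀ k, ∫⁻ s, (G k s : ℝ≥0∞) ∂μ₂ ≠ ∞)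
    (k : K) : ratioLaw μ₁ F k = ratioLaw μ₂ G k := by
  classical
  let π : K → Set (Set (K → ℝ≥0)) := fun j => range fun c : ℝ≥0 => {x | x j < c}
  have hπ : ∀ j, IsPiSystem (π j) := by
    rintro j _ ⟨c, rfl⟩ _ ⟨d, rfl⟩ -
    exact ⟨min c d, by ext x; simp⟩
  have hmeas : ∀ j (c : ℝ≥0), MeasurableSet {x : K → ℝ≥0 | x j < c} := fun j c =>
    measurableSet_lt (measurable_pi_apply j) measurable_const
  have hgen : (MeasurableSpace.pi : MeasurableSpace (K → ℝ≥0)) =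
      MeasurableSpace.generateFrom (piiUnionInter π univ) := by
    apply le_antisymm
    · refine iSup_le fun j => ?_
      rw [← measurable_iff_comap_le]
      let _ : MeasurableSpace (K → ℝ≥0) := MeasurableSpace.generateFrom (piiUnionInter π univ)
      refine measurable_of_Iio fun c => ?_
      refine MeasurableSpace.measurableSet_generateFrom ⟨{j}, by simp, fun _ => {x | x j < c},
        ?_, by simp; rfl⟩
      intro i hi
      rw [Finset.mem_singleton.1 hi]
      exact ⟨c, rfl⟩
    · refine MeasurableSpace.generateFrom_le ?_
      rintro _ ⟨J, -, C, hC, rfl⟩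
      refine Finset.measurableSet_biInter _ fun j hj => ?_
      obtain ⟨c, hc⟩ := hC j hj
      rw [← hc]
      exact hmeas j c
  have : IsFiniteMeasure (μ₁.withDensity fun s => (F k s : ℝ≥0∞)) :=
    isFiniteMeasure_withDensity (hFfin k)
  have : IsFiniteMeasure (ratioLaw μ₁ F k) := by unfold ratioLaw; infer_instance
  refine ext_of_generate_finite _ hgen (isPiSystem_piiUnionInter _ hπ _) ?_ ?_
  · rintro _ ⟨J, -, C, hC, rfl⟩
    choose! c hc using hC
    have hC' : (⋂ j ∈ J, C j) = ⋂ j ∈ J, {x | x j < c j} :=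
      iInter₂_congr fun j hj => (hc j hj).symm
    rw [hC']
    by_cases hpos : ∀ j ∈ J, 0 < c j
    · have hB : MeasurableSet (⋂ j ∈ J, {x : K → ℝ≥0 | x j < c j}) :=
        Finset.measurableSet_biInter _ fun j _ => hmeas j _
      rw [ratioLaw_apply μ₁ hF k hB, ratioLaw_apply μ₂ hG k hB, indicator_ratio_box F k J c hpos,
        indicator_ratio_box G k J c hpos]
      exact h.lintegral_indicator_eq hF hG hFfin hGfin J k _
    · push Not at hpos
      obtain ⟨j, hj, hj0⟩ := hpos
      have : (⋂ j ∈ J, {x : K → ℝ≥0 | x j < c j}) = ∅ := by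
        refine subset_empty_iff.1 fun x hx => ?_
        have := mem_iInter₂.1 hx j hj
        exact absurd (lt_of_lt_of_le this hj0) (by simp)
      simp [this]
  · rw [ratioLaw_apply μ₁ hF k .univ, ratioLaw_apply μ₂ hG k .univ]
    have := h {k} 1
    simpa using this

theorem EqualMaxIntegrals.lintegral_restrict_eq {μ₁ : Measure S₁} {μ₂ : Measure S₂}
    {F : K → S₁ → ℝ≥0} {G : K → S₂ → ℝ≥0} (h : EqualMaxIntegrals μ₁ μ₂ F G)
    (hF : ∀ k, Measurable (F k)) (hG : ∀ k, Measurable (G k))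
    (hFfin : ∀ k, ∫⁻ s, (F k s : ℝ≥0∞) ∂μ₁ ≠ ∞) (hGfin : ∀ k, ∫⁻ s, (G k s : ℝ≥0∞) ∂μ₂ ≠ ∞)
    {H : (K → ℝ≥0) → ℝ≥0∞} (hH : Measurable H)
    (hom : ∀ (r : ℝ≥0) x, 0 < r → H (r • x) = r * H x) (k : K) (h0 : ∀ x, x k = 0 → H x = 0) :
    ∫⁻ s, H (fun j => F j s) ∂μ₁ = ∫⁻ s, H (fun j => G j s) ∂μ₂ := by
  rw [lintegral_ratioLaw μ₁ hF hH hom k h0, lintegral_ratioLaw μ₂ hG hH hom k h0,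
    h.ratioLaw_eq hF hG hFfin hGfin]

/-- No single coordinate need be nonzero on the set where `H` lives, so the cone is cut according to
the first nonzero coordinate along `u`. Each piece is scale invariant and has its own reference
coordinate. -/
theorem EqualMaxIntegrals.lintegral_eq {μ₁ : Measure S₁} {μ₂ : Measure S₂}
    {F : K → S₁ → ℝ≥0} {G : K → S₂ → ℝ≥0} (h : EqualMaxIntegrals μ₁ μ₂ F G)
    (hF : ∀ k, Measurable (F k)) (hG : ∀ k, Measurable (G k))
    (hFfin : ∀ k, ∫⁻ s, (F k s : ℝ≥0∞) ∂μ₁ ≠ ∞) (hGfin : ∀ k, ∫⁻ s, (G k s : ℝ≥0∞) ∂μ₂ ≠ ∞)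
    {H : (K → ℝ≥0) → ℝ≥0∞} (hH : Measurable H)
    (hom : ∀ (r : ℝ≥0) x, 0 < r → H (r • x) = r * H x) (u : ℕ → K)
    (h0 : ∀ x, (∀ n, x (u n) = 0) → H x = 0) :
    ∫⁻ s, H (fun j => F j s) ∂μ₁ = ∫⁻ s, H (fun j => G j s) ∂μ₂ := by
  classical
  let D : ℕ → Set (K → ℝ≥0) := fun n => {x | x (u n) ≠ 0 ∧ ∀ m < n, x (u m) = 0}
  have hD : ∀ n, MeasurableSet (D n) := fun n => by
    have : D n = {x | x (u n) = 0}ᶜ ∩ ⋂ m, ⋂ (_ : m < n), {x | x (u m) = 0} := by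
      ext x; simp [D]
    rw [this]
    have hz : ∀ m, MeasurableSet {x : K → ℝ≥0 | x (u m) = 0} := fun m =>
      measurable_pi_apply (u m) (measurableSet_singleton 0)
    exact (hz n).compl.inter (.iInter fun m => .iInter fun _ => hz m)
  have hsum : ∀ x, H x = ∑' n, (D n).indicator H x := by
    intro x
    by_cases hx : ∀ n, x (u n) = 0
    · simp [indicator_apply, h0 x hx]
    · push Not at hx
      rw [tsum_eq_single (Nat.find hx), indicator_of_mem]
      · exact ⟨Nat.find_spec hx, fun m hm => not_not.1 (Nat.find_min hx hm)⟩
      · refine fun n hn => indicator_of_notMem (fun hxn => hn ?_) _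
        exact ((Nat.find_eq_iff hx).2 ⟨hxn.1, fun m hm => not_not.2 (hxn.2 m hm)⟩).symm
  have hFm : Measurable fun s j => F j s := measurable_pi_lambda _ hF
  have hGm : Measurable fun s j => G j s := measurable_pi_lambda _ hG
  simp only [fun s => hsum fun j => F j s, fun s => hsum fun j => G j s]
  rw [lintegral_tsum (f := fun n s => (D n).indicator H fun j => F j s)
      fun n => ((hH.indicator (hD n)).comp hFm).aemeasurable,
    lintegral_tsum (f := fun n s => (D n).indicator H fun j => G j s)
      fun n => ((hH.indicator (hD n)).comp hGm).aemeasurable]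
  refine tsum_congr fun n => h.lintegral_restrict_eq hF hG hFfin hGfin (hH.indicator (hD n)) ?_
    (u n) fun x hx => indicator_of_notMem (fun hxn => hxn.1 hx) _
  intro r x hr
  have : r • x ∈ D n ↔ x ∈ D n := by simp [D, hr.ne']
  simp only [indicator_apply, this, hom r x hr]
  split_ifs <;> simp

/-- All finite max-linear combinations of the `f k` and of the `g k`, with nonnegative
coefficients, have equal `L^α_+` norms. -/
structure SameNorms (α : ℝ) (μ₁ : Measure S₁) (μ₂ : Measure S₂) (f : K → S₁ → ℝ≥0)
    (g : K → S₂ → ℝ≥0) : Prop where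
  left_mem : ∀ k, f k ∈ Lplus α μ₁
  right_mem : ∀ k, g k ∈ Lplus α μ₂
  norms : ∀ (J : Finset K) (a : K → ℝ≥0), J.Nonempty → (∀ k ∈ J, 0 < a k) →
    ∫⁻ s, ((J.sup fun k => a k * f k s : ℝ≥0) : ℝ≥0∞) ^ α ∂μ₁ =
      ∫⁻ s, ((J.sup fun k => a k * g k s : ℝ≥0) : ℝ≥0∞) ^ α ∂μ₂

theorem sup_mul_rpow {α : ℝ} (hα : 0 < α) (J : Finset K) (a x : K → ℝ≥0) :
    (J.sup fun k => a k * x k) ^ α = J.sup fun k => a k ^ α * x k ^ α := by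
  simp only [← NNReal.mul_rpow]
  exact Finset.apply_sup_eq_sup_comp_of_linearOrder (fun y : ℝ≥0 => y ^ α)
    (NNReal.monotone_rpow_of_nonneg hα.le) (by simp [hα.ne'])

theorem SameNorms.equalMaxIntegrals {α : ℝ} (hα : 0 < α) {μ₁ : Measure S₁} {μ₂ : Measure S₂}
    {f : K → S₁ → ℝ≥0} {g : K → S₂ → ℝ≥0} (h : SameNorms α μ₁ μ₂ f g) :
    EqualMaxIntegrals μ₁ μ₂ (fun k s => f k s ^ α) (fun k s => g k s ^ α) := by
  classical
  intro J b
  -- The norms are only compared for nonempty index sets with positive coefficients, hence the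
  -- removal of the zero coefficients.
  have key : ∀ x : K → ℝ≥0, (J.sup fun k => b k * x k ^ α) =
      ((J.filter fun k => b k ≠ 0).sup fun k => b k ^ α⁻¹ * x k) ^ α := by
    intro x
    rw [sup_mul_rpow hα]
    simp only [NNReal.rpow_inv_rpow hα.ne']
    refine le_antisymm (Finset.sup_le fun k hk => ?_)
      (Finset.sup_mono (Finset.filter_subset _ _))
    by_cases hb : b k = 0
    · simp [hb]
    · exact Finset.le_sup (f := fun k => b k * x k ^ α) (Finset.mem_filter.2 ⟨hk, hb⟩)
  simp only [key fun k => f k _, key fun k => g k _, ENNReal.coe_rpow_of_nonneg _ hα.le]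
  by_cases hJ : (J.filter fun k => b k ≠ 0).Nonempty
  · exact h.norms _ _ hJ fun k hk =>
      NNReal.rpow_pos (pos_iff_ne_zero.2 (Finset.mem_filter.1 hk).2)
  · rw [Finset.not_nonempty_iff_eq_empty] at hJ
    simp [hJ, hα]

/-- Composition with the coordinatewise power `x ↦ x^{1/α}` reduces degree `α` to degree one. -/
theorem SameNorms.lintegral_eq {α : ℝ} (hα : 0 < α) {μ₁ : Measure S₁} {μ₂ : Measure S₂}
    {f : K → S₁ → ℝ≥0} {g : K → S₂ → ℝ≥0} (h : SameNorms α μ₁ μ₂ f g)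
    {H : (K → ℝ≥0) → ℝ≥0∞} (hH : Measurable H)
    (hom : ∀ (r : ℝ≥0) x, 0 < r → H (r • x) = (r : ℝ≥0∞) ^ α * H x) (u : ℕ → K)
    (h0 : ∀ x, (∀ n, x (u n) = 0) → H x = 0) :
    ∫⁻ s, H (fun k => f k s) ∂μ₁ = ∫⁻ s, H (fun k => g k s) ∂μ₂ := by
  have hm : Measurable fun (x : K → ℝ≥0) k => x k ^ α⁻¹ :=
    measurable_pi_lambda _ fun k => (measurable_pi_apply k).pow_const _
  have := (h.equalMaxIntegrals hα).lintegral_eq (fun k => (h.left_mem k).1.pow_const _)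
    (fun k => (h.right_mem k).1.pow_const _)
    (fun k => by simpa [ENNReal.coe_rpow_of_nonneg _ hα.le] using (h.left_mem k).2.ne)
    (fun k => by simpa [ENNReal.coe_rpow_of_nonneg _ hα.le] using (h.right_mem k).2.ne)
    (hH.comp hm) ?_ u ?_
  · simpa only [Function.comp_def, NNReal.rpow_rpow_inv hα.ne'] using this
  · intro r x hr
    have h1 : (fun k => (r • x) k ^ α⁻¹) = r ^ α⁻¹ • fun k => x k ^ α⁻¹ := by
      ext k; simp [NNReal.mul_rpow]
    simp only [Function.comp_def, h1]
    rw [hom _ _ (NNReal.rpow_pos hr), ← ENNReal.coe_rpow_of_nonneg _ hα.le,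
      NNReal.rpow_inv_rpow hα.ne']
  · exact fun x hx => h0 _ fun n => by simp [hx n, hα.ne']

end Homogeneous

/-! ### Decoding points from spectral vectors, and transport to the second representation. -/

section Decoder

variable {S₁ S₂ K : Type*} [MeasurableSpace S₁] [MeasurableSpace S₂]

/-- A homogeneous way to recover the point `s` from the vector `(f_k(s))_k`, up to `μ₁`-null sets:
`Θ` recovers the point and is scale invariant, `L` is a homogeneous nonzero normalization. -/
structure IsDecoder (μ₁ : Measure S₁) (f : K → S₁ → ℝ≥0) (Θ : (K → ℝ≥0) → S₁)
    (L : (K → ℝ≥0) → ℝ≥0) : Prop where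
  measurable_point : Measurable Θ
  measurable_scale : Measurable L
  point_smul : ∀ (r : ℝ≥0) x, 0 < r → Θ (r • x) = Θ x
  scale_smul : ∀ (r : ℝ≥0) x, 0 < r → L (r • x) = r * L x
  exists_seq : ∃ u : ℕ → K, ∀ x, L x = 0 ↔ ∀ n, x (u n) = 0
  point_eq : ∀ᵐ s ∂μ₁, Θ (fun k => f k s) = s
  scale_ne : ∀ᵐ s ∂μ₁, L (fun k => f k s) ≠ 0

/-- The factor `L(g) / L(f ∘ Θ(g))`, replaced by `1` where it vanishes. -/
def decodedFactor (f : K → S₁ → ℝ≥0) (Θ : (K → ℝ≥0) → S₁) (L : (K → ℝ≥0) → ℝ≥0)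
    (x : K → ℝ≥0) : ℝ≥0 :=
  open Classical in
  if L x / L (fun k => f k (Θ x)) = 0 then 1 else L x / L (fun k => f k (Θ x))

/-- The image of `φ` under the isometry that takes the `f_k` to the `g_k`. -/
def transport (f : K → S₁ → ℝ≥0) (g : K → S₂ → ℝ≥0) (Θ : (K → ℝ≥0) → S₁)
    (L : (K → ℝ≥0) → ℝ≥0) (φ : S₁ → ℝ≥0) : S₂ → ℝ≥0 :=
  {s | L (fun k => g k s) ≠ 0}.indicator fun s =>
    decodedFactor f Θ L (fun k => g k s) * φ (Θ fun k => g k s)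

theorem decodedFactor_pos {S : Type*} (f : K → S → ℝ≥0) (Θ : (K → ℝ≥0) → S) (L : (K → ℝ≥0) → ℝ≥0)
    (x : K → ℝ≥0) : 0 < decodedFactor f Θ L x := by
  unfold decodedFactor
  split_ifs with h
  · exact one_pos
  · exact pos_iff_ne_zero.2 h

/-- The transfer principle: the integral of `Q^α` over the scale-invariant set `W` is the same for
both families, so if it vanishes for `f` it vanishes for `g`. With `Q` a normalization and `W` the
failure set of an identity, that identity passes from `f` to `g`. -/
theorem SameNorms.ae_eq_zero_of_mem {α : ℝ} (hα : 0 < α) {μ₁ : Measure S₁} {μ₂ : Measure S₂}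
    {f : K → S₁ → ℝ≥0} {g : K → S₂ → ℝ≥0} (h : SameNorms α μ₁ μ₂ f g) {Q : (K → ℝ≥0) → ℝ≥0}
    (hQ : Measurable Q) (hQhom : ∀ (r : ℝ≥0) x, 0 < r → Q (r • x) = r * Q x)
    {W : Set (K → ℝ≥0)} (hW : MeasurableSet W) (hWhom : ∀ (r : ℝ≥0) x, 0 < r → (r • x ∈ W ↔ x ∈ W))
    (u : ℕ → K) (h0 : ∀ x, (∀ n, x (u n) = 0) → Q x = 0)
    (hf : ∀ᵐ s ∂μ₁, (fun k => f k s) ∈ W → Q (fun k => f k s) = 0) :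
    ∀ᵐ s ∂μ₂, (fun k => g k s) ∈ W → Q (fun k => g k s) = 0 := by
  classical
  have hH : Measurable (W.indicator fun x => (Q x : ℝ≥0∞) ^ α) :=
    (hQ.coe_nnreal_ennreal.pow_const α).indicator hW
  have hg : Measurable fun s k => g k s := measurable_pi_lambda _ fun k => (h.right_mem k).1
  have key := h.lintegral_eq hα hH ?_ u ?_
  · have hzero : ∫⁻ s, W.indicator (fun x => (Q x : ℝ≥0∞) ^ α) (fun k => f k s) ∂μ₁ = 0 := by
      rw [← lintegral_zero (μ := μ₁)]
      refine lintegral_congr_ae (hf.mono fun s hs => ?_)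
      by_cases hsW : (fun k => f k s) ∈ W
      · simp [indicator_of_mem hsW, hs hsW, hα]
      · simp [indicator_of_notMem hsW]
    rw [hzero, eq_comm, lintegral_eq_zero_iff (show Measurable fun s =>
      W.indicator (fun x => (Q x : ℝ≥0∞) ^ α) fun k => g k s from hH.comp hg)] at key
    refine key.mono fun s hs hsW => ?_
    simpa [indicator_of_mem hsW, ENNReal.rpow_eq_zero_iff, hα, hα.not_gt] using hs
  · intro r x hr
    simp only [indicator_apply, hWhom r x hr, hQhom r x hr]
    split_ifs
    · rw [ENNReal.coe_mul, ENNReal.mul_rpow_of_nonneg _ _ hα.le]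
    · simp
  · intro x hx
    simp [h0 x hx, hα]

variable {α : ℝ} {μ₁ : Measure S₁} {μ₂ : Measure S₂} {f : K → S₁ → ℝ≥0} {g : K → S₂ → ℝ≥0}
  {Θ : (K → ℝ≥0) → S₁} {L : (K → ℝ≥0) → ℝ≥0}

theorem IsDecoder.measurable_decoded (hd : IsDecoder μ₁ f Θ L) (hf : ∀ k, Measurable (f k)) :
    Measurable fun x => L (fun k => f k (Θ x)) :=
  hd.measurable_scale.comp (measurable_pi_lambda _ fun k => (hf k).comp hd.measurable_point)

theorem IsDecoder.measurable_decodedFactor (hd : IsDecoder μ₁ f Θ L)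
    (hf : ∀ k, Measurable (f k)) : Measurable (decodedFactor f Θ L) := by
  have hm := hd.measurable_scale.div (hd.measurable_decoded hf)
  exact Measurable.ite (hm (measurableSet_singleton 0)) measurable_const hm

theorem IsDecoder.ae_scale_decoded_ne (hd : IsDecoder μ₁ f Θ L) (hα : 0 < α)
    (h : SameNorms α μ₁ μ₂ f g) :
    ∀ᵐ s ∂μ₂, L (fun k => g k s) ≠ 0 → L (fun k => f k (Θ fun k => g k s)) ≠ 0 := by
  obtain ⟨u, hu⟩ := hd.exists_seq
  have := h.ae_eq_zero_of_mem hα hd.measurable_scale hd.scale_smul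
    (hd.measurable_decoded (fun k => (h.left_mem k).1) (measurableSet_singleton 0))
    (fun r x hr => by simp [hd.point_smul r x hr]) u (fun x hx => (hu x).2 hx) ?_
  · exact this.mono fun s hs h1 h2 => h1 (hs h2)
  · filter_upwards [hd.point_eq, hd.scale_ne] with s h1 h2 h3
    simp only [mem_preimage, h1, mem_singleton_iff] at h3
    exact h3

theorem IsDecoder.ae_eq_zero (hd : IsDecoder μ₁ f Θ L) (hα : 0 < α)
    (h : SameNorms α μ₁ μ₂ f g) (k : K) :
    ∀ᵐ s ∂μ₂, L (fun k => g k s) = 0 → g k s = 0 := by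
  have := h.ae_eq_zero_of_mem hα (measurable_pi_apply k) (fun r x _ => rfl)
    (hd.measurable_scale (measurableSet_singleton 0))
    (fun r x hr => by simp [hd.scale_smul r x hr, hr.ne']) (fun _ => k) (fun x hx => hx 0) ?_
  · exact this
  · exact hd.scale_ne.mono fun s h1 h2 => absurd h2 h1

/-- Both sides are homogeneous of degree one in the vector `(g_k)_k`, so the failure set is scale
invariant. For `f` itself the decoded point is `s` and the identity is commutativity of the product.
-/
theorem IsDecoder.ae_mul_eq (hd : IsDecoder μ₁ f Θ L) (hα : 0 < α)
    (h : SameNorms α μ₁ μ₂ f g) (k : K) :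
    ∀ᵐ s ∂μ₂, L (fun k => g k s) ≠ 0 → g k s * L (fun k => f k (Θ fun k => g k s)) =
      L (fun k => g k s) * f k (Θ fun k => g k s) := by
  obtain ⟨u, hu⟩ := hd.exists_seq
  have hfm := fun k => (h.left_mem k).1
  have := h.ae_eq_zero_of_mem hα hd.measurable_scale hd.scale_smul
    (W := {x | x k * L (fun k => f k (Θ x)) = L x * f k (Θ x)}ᶜ)
    (measurableSet_eq_fun ((measurable_pi_apply k).mul (hd.measurable_decoded hfm))
      (hd.measurable_scale.mul ((hfm k).comp hd.measurable_point))).compl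
    (fun r x hr => ?_) u (fun x hx => (hu x).2 hx) ?_
  · refine this.mono fun s hs h1 => ?_
    by_contra hne
    exact h1 (hs hne)
  · simp only [mem_compl_iff, mem_ofPred_eq, hd.point_smul r x hr, hd.scale_smul r x hr,
      Pi.smul_apply, smul_eq_mul, mul_assoc]
    rw [mul_right_inj' hr.ne']
  · filter_upwards [hd.point_eq] with s h1 h3
    refine absurd ?_ h3
    simp only [mem_ofPred_eq, h1]
    exact mul_comm _ _

theorem IsDecoder.ae_eq_transport (hd : IsDecoder μ₁ f Θ L) (hα : 0 < α)
    (h : SameNorms α μ₁ μ₂ f g) (k : K) : g k =ᵐ[μ₂] transport f g Θ L (f k) := by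
  filter_upwards [hd.ae_scale_decoded_ne hα h, hd.ae_eq_zero hα h k, hd.ae_mul_eq hα h k]
    with s h1 h2 h3
  by_cases h0 : L (fun k => g k s) = 0
  · rw [h2 h0, transport, indicator_of_notMem (by simpa using h0)]
  · rw [transport, indicator_of_mem (by exact h0), decodedFactor, if_neg (div_ne_zero h0 (h1 h0)),
      div_mul_eq_mul_div, ← h3 h0, mul_div_cancel_right₀ _ (h1 h0)]

/-- The functional `1_B(Θ x) (L x / L(f(Θ x)))^α` is integrated against both families. Along `f` the
quotient is `1` a.e., giving `μ₁ B`; along `g` it is the density `h^α` on the preimage of `B`. -/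
theorem IsDecoder.measure_eq (hd : IsDecoder μ₁ f Θ L) (hα : 0 < α)
    (h : SameNorms α μ₁ μ₂ f g) :
    μ₁ = ((μ₂.restrict {s | L (fun k => g k s) ≠ 0}).withDensity fun s =>
      (decodedFactor f Θ L (fun k => g k s) : ℝ≥0∞) ^ α).map fun s => Θ fun k => g k s := by
  obtain ⟨u, hu⟩ := hd.exists_seq
  have hfm := fun k => (h.left_mem k).1
  have hg : Measurable fun s k => g k s := measurable_pi_lambda _ fun k => (h.right_mem k).1
  classical
  ext B hB
  have hA : MeasurableSet {s | L (fun k => g k s) ≠ 0} :=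
    (hd.measurable_scale.comp hg (measurableSet_singleton 0)).compl
  have hB' : MeasurableSet ((fun s => Θ fun k => g k s) ⁻¹' B) :=
    (hd.measurable_point.comp hg) hB
  have hm : Measurable fun x => L x / L (fun k => f k (Θ x)) :=
    hd.measurable_scale.div (hd.measurable_decoded hfm)
  have key := h.lintegral_eq hα (H := (Θ ⁻¹' B).indicator fun x =>
      ((L x / L (fun k => f k (Θ x)) : ℝ≥0) : ℝ≥0∞) ^ α)
    ((hm.coe_nnreal_ennreal.pow_const α).indicator (hd.measurable_point hB)) ?_ u ?_
  · rw [Measure.map_apply (show Measurable fun s => Θ fun k => g k s from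
      hd.measurable_point.comp hg) hB, withDensity_apply _ hB',
      Measure.restrict_restrict hB', ← lintegral_indicator (hB'.inter hA)]
    have h1 : μ₁ B = ∫⁻ s, (Θ ⁻¹' B).indicator (fun x =>
        ((L x / L (fun k => f k (Θ x)) : ℝ≥0) : ℝ≥0∞) ^ α) (fun k => f k s) ∂μ₁ := by
      rw [← lintegral_indicator_one hB]
      refine lintegral_congr_ae ?_
      filter_upwards [hd.point_eq, hd.scale_ne] with s h2 h3
      simp only [indicator_apply, mem_preimage, h2, div_self h3]
      simp
    rw [h1, key]
    refine lintegral_congr_ae ?_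
    filter_upwards [hd.ae_scale_decoded_ne hα h] with s h2
    by_cases h0 : L (fun k => g k s) = 0
    · simp [indicator_apply, h0, hα]
    · simp only [indicator_apply, mem_preimage, mem_inter_iff, mem_ofPred_eq, ne_eq, h0,
        not_false_eq_true, and_true, decodedFactor, div_eq_zero_iff, h2 h0, or_self, if_false]
  · intro r x hr
    simp only [indicator_apply, mem_preimage, hd.point_smul r x hr, hd.scale_smul r x hr]
    split_ifs
    · rw [mul_div_assoc, ENNReal.coe_mul, ENNReal.mul_rpow_of_nonneg _ _ hα.le]
    · simp
  · intro x hx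
    simp [(hu x).2 hx, hα]

/-- Prepend one function to a family. -/
def consFamily {S : Type*} (φ : S → ℝ≥0) (f : K → S → ℝ≥0) : Option K → S → ℝ≥0
  | none => φ
  | some k => f k

theorem IsDecoder.consFamily (hd : IsDecoder μ₁ f Θ L) (φ : S₁ → ℝ≥0) :
    IsDecoder μ₁ (consFamily φ f) (fun x => Θ fun k => x (some k))
      (fun x => L fun k => x (some k)) := by
  have hm : Measurable fun (x : Option K → ℝ≥0) (k : K) => x (some k) :=
    measurable_pi_lambda _ fun k => measurable_pi_apply _
  obtain ⟨u, hu⟩ := hd.exists_seq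
  exact {
    measurable_point := hd.measurable_point.comp hm
    measurable_scale := hd.measurable_scale.comp hm
    point_smul := fun r x hr => hd.point_smul r _ hr
    scale_smul := fun r x hr => hd.scale_smul r _ hr
    exists_seq := ⟨fun n => some (u n), fun x => hu _⟩
    point_eq := hd.point_eq
    scale_ne := hd.scale_ne }

/-- Source of all uniqueness of isometries: the decoder ignores the adjoined coordinate, so the
representation of the enlarged family uses the same point map and factor. -/
theorem IsDecoder.ae_eq_transport_of_consFamily (hd : IsDecoder μ₁ f Θ L) (hα : 0 < α)
    {φ : S₁ → ℝ≥0} {ψ : S₂ → ℝ≥0}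
    (h : SameNorms α μ₁ μ₂ (MaxStable.consFamily φ f) (MaxStable.consFamily ψ g)) :
    ψ =ᵐ[μ₂] transport f g Θ L φ :=
  (hd.consFamily φ).ae_eq_transport hα h none

end Decoder

/-! ### Building a decoder from minimality. -/

section Span

variable {S T : Type*} [MeasurableSpace S] {α : ℝ} {μ : Measure S} {f : T → S → ℝ≥0}

/-- Countably many approximants of `φ` involve only countably many `f_t`. Where all of these vanish
so do the approximants, and there `∫ φ^α` is bounded by their distances to `φ`. -/
theorem exists_seq_of_mem_closedMaxSpan (hα : 0 < α) {φ : S → ℝ≥0}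
    (hφ : φ ∈ closedMaxSpan α μ f) : ∃ u : ℕ → T, ∀ Z : Set S, MeasurableSet Z →
      (∀ n, ∀ᵐ s ∂μ, s ∈ Z → f (u n) s = 0) → ∀ᵐ s ∂μ, s ∈ Z → φ s = 0 := by
  have hpos : ∀ n : ℕ, (0 : ℝ≥0∞) < ((n : ℝ≥0∞) + 1)⁻¹ := fun n =>
    ENNReal.inv_pos.2 (by finiteness)
  choose ψ hψ hψφ using fun n : ℕ => hφ.2 _ (hpos n)
  choose J hJ a ha hψ' using hψ
  have hcount : (⋃ n, (J n : Set T)).Countable := countable_iUnion fun n => (J n).countable_toSet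
  have hne : (⋃ n, (J n : Set T)).Nonempty := by
    obtain ⟨t, ht⟩ := hJ 0
    exact ⟨t, mem_iUnion.2 ⟨0, ht⟩⟩
  obtain ⟨u, hu⟩ := hcount.exists_eq_range hne
  refine ⟨u, fun Z hZ h0 => ?_⟩
  have h1 : ∀ᵐ s ∂μ, s ∈ Z → ∀ n, ψ n s = 0 := by
    filter_upwards [ae_all_iff.2 h0] with s hs hsZ n
    rw [hψ' n]
    refine le_antisymm (Finset.sup_le fun t ht => ?_) zero_le
    have : t ∈ range u := hu ▸ mem_iUnion.2 ⟨n, ht⟩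
    obtain ⟨m, rfl⟩ := this
    simp [hs m hsZ]
  have h2 : ∀ n : ℕ, ∫⁻ s in Z, (φ s : ℝ≥0∞) ^ α ∂μ ≤ ((n : ℝ≥0∞) + 1)⁻¹ := by
    intro n
    refine le_trans ?_ (hψφ n).le
    refine le_trans (lintegral_mono_ae ?_) (setLIntegral_le_lintegral Z _)
    refine (ae_restrict_iff' hZ).2 ?_
    filter_upwards [h1] with s hs hsZ
    simp [hs hsZ n, hα.ne', edist_comm, ← ENNReal.coe_rpow_of_nonneg _ hα.le, edist_nndist]
  have h3 : ∫⁻ s in Z, (φ s : ℝ≥0∞) ^ α ∂μ = 0 := by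
    refine le_antisymm (ge_of_tendsto' (x := atTop) ?_ h2) zero_le
    have := ENNReal.tendsto_inv_nat_nhds_zero.comp (tendsto_add_atTop_nat 1)
    simpa [Function.comp_def] using this
  rw [lintegral_eq_zero_iff (hφ.1.1.coe_nnreal_ennreal.pow_const α)] at h3
  rw [Filter.EventuallyEq, ae_restrict_iff' hZ] at h3
  refine h3.mono fun s hs hsZ => ?_
  simpa [hα, hα.not_gt] using hs hsZ

/-- A homogeneous normalization: the first nonzero entry of `x` along the sequence `u`. -/
theorem exists_homogeneous_scale (u : ℕ → T) : ∃ L : (T → ℝ≥0) → ℝ≥0, Measurable L ∧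
    (∀ (r : ℝ≥0) x, 0 < r → L (r • x) = r * L x) ∧ ∀ x, L x = 0 ↔ ∀ n, x (u n) = 0 := by
  classical
  have hex : ∀ x : T → ℝ≥0, ∃ n, x (u n) ≠ 0 ∨ ∀ m, x (u m) = 0 := by
    intro x
    by_cases h : ∀ m, x (u m) = 0
    · exact ⟨0, Or.inr h⟩
    · push Not at h
      exact h.imp fun n hn => Or.inl hn
  refine ⟨fun x => x (u (Nat.find (hex x))), ?_, ?_, ?_⟩
  · have hz : ∀ m, MeasurableSet {x : T → ℝ≥0 | x (u m) = 0} := fun m =>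
      measurable_pi_apply (u m) (measurableSet_singleton 0)
    refine Measurable.find (f := fun n x => x (u n)) (fun n => ?_) (fun n => ?_) hex
    · exact measurable_pi_apply (u n)
    have : {x : T → ℝ≥0 | x (u n) ≠ 0 ∨ ∀ m, x (u m) = 0} =
        {x | x (u n) = 0}ᶜ ∪ ⋂ m, {x | x (u m) = 0} := by ext x; simp
    rw [this]
    exact (hz n).compl.union (.iInter hz)
  · intro r x hr
    have : Nat.find (hex (r • x)) = Nat.find (hex x) := by
      refine (Nat.find_eq_iff _).2 ⟨?_, fun m hm => ?_⟩
      · simpa [hr.ne'] using Nat.find_spec (hex x)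
      · simpa [hr.ne'] using Nat.find_min (hex x) hm
    change r * x (u (Nat.find (hex (r • x)))) = _
    rw [this]
  · intro x
    rcases Nat.find_spec (hex x) with h | h
    · exact ⟨fun h' => absurd h' h, fun h' => h' _⟩
    · simp [h]

/-- Ratios are unchanged by scaling and involve two coordinates each; the sets cut out by cones
depending on countably many coordinates form a σ-field containing the generators. -/
theorem exists_cone_of_measurableSet_ratioSigma {S : Type*} {f : T → S → ℝ≥0} {A : Set S}
    (hA : MeasurableSet[ratioSigma f] A) : ∃ C : Set (T → ℝ≥0), MeasurableSet C ∧
      (∀ (r : ℝ≥0) x, 0 < r → (r • x ∈ C ↔ x ∈ C)) ∧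
      (∃ J : Set T, J.Countable ∧ ∀ x y, EqOn x y J → (x ∈ C ↔ y ∈ C)) ∧
      A = {s | (fun t => f t s) ∈ C} := by
  let m : MeasurableSpace S :=
    { MeasurableSet' := fun A => ∃ C : Set (T → ℝ≥0), MeasurableSet C ∧
        (∀ (r : ℝ≥0) x, 0 < r → (r • x ∈ C ↔ x ∈ C)) ∧
        (∃ J : Set T, J.Countable ∧ ∀ x y, EqOn x y J → (x ∈ C ↔ y ∈ C)) ∧
        A = {s | (fun t => f t s) ∈ C}
      measurableSet_empty := ⟨∅, .empty, by simp, ⟨∅, by simp⟩, by simp⟩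
      measurableSet_compl := by
        rintro _ ⟨C, hC, h1, ⟨J, hJ, h2⟩, rfl⟩
        exact ⟨Cᶜ, hC.compl, fun r x hr => not_congr (h1 r x hr),
          ⟨J, hJ, fun x y hxy => not_congr (h2 x y hxy)⟩, rfl⟩
      measurableSet_iUnion := by
        intro B hB
        choose C hC h1 h2 h3 using hB
        choose J hJ h4 using h2
        refine ⟨⋃ n, C n, .iUnion hC, fun r x hr => ?_, ⟨⋃ n, J n, countable_iUnion hJ,
          fun x y hxy => ?_⟩, ?_⟩
        · simp only [mem_iUnion, h1 _ r x hr]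
        · simp only [mem_iUnion]
          exact exists_congr fun n => h4 n x y (hxy.mono (subset_iUnion J n))
        · ext s
          simp [h3] }
  refine (?_ : ratioSigma f ≤ m) A hA
  refine iSup_le fun t₁ => iSup_le fun t₂ => ?_
  rintro _ ⟨B, hB, rfl⟩
  refine ⟨{x | (x t₁ : ℝ≥0∞) / x t₂ ∈ B}, ?_, fun r x hr => ?_, ⟨{t₁, t₂}, by simp,
    fun x y hxy => ?_⟩, rfl⟩
  · exact ((measurable_pi_apply t₁).coe_nnreal_ennreal.div
      (measurable_pi_apply t₂).coe_nnreal_ennreal) hB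
  · simp only [mem_ofPred_eq, Pi.smul_apply, smul_eq_mul, ENNReal.coe_mul]
    rw [ENNReal.mul_div_mul_left _ _ (by simpa using hr.ne') (by simp)]
  · simp only [mem_ofPred_eq, hxy (mem_insert t₁ _), hxy (mem_insert_of_mem t₁ rfl)]

/-- A real number is the supremum of the rationals below it. Each set `{q < s}` is, up to a null
set, given by a cone `C q`, so `s` is recovered as the supremum of the `q` whose cone contains the
vector. -/
theorem exists_point_decoder {Y : Set ℝ} (hY : MeasurableSet Y) [Nonempty Y] {μ : Measure Y}
    {f : T → Y → ℝ≥0} (hratio : ∀ B : Set Y, MeasurableSet B →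
      ∃ A : Set Y, MeasurableSet[ratioSigma f] A ∧ μ (symmDiff A B) = 0) :
    ∃ Θ : (T → ℝ≥0) → Y, Measurable Θ ∧ (∀ (r : ℝ≥0) x, 0 < r → Θ (r • x) = Θ x) ∧
      (∃ J : Set T, J.Countable ∧ ∀ x y, EqOn x y J → Θ x = Θ y) ∧
      ∀ᵐ s ∂μ, Θ (fun t => f t s) = s := by
  classical
  have hB : ∀ q : ℚ, MeasurableSet {s : Y | (q : ℝ) < s} := fun q =>
    measurableSet_lt measurable_const measurable_subtype_coe
  choose A hA hAB using fun q => hratio _ (hB q)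
  choose C hC hCsmul hCdep hAC using fun q => exists_cone_of_measurableSet_ratioSigma (hA q)
  choose J hJ hCJ using hCdep
  let E : (T → ℝ≥0) → EReal := fun x => ⨆ q : ℚ, if x ∈ C q then ((q : ℝ) : EReal) else ⊥
  have hE : Measurable E := .iSup fun q => Measurable.ite (hC q) measurable_const measurable_const
  -- A measurable retraction of `ℝ` onto `Y` gives vectors that decode to no point of `Y` a value as
  -- well.
  obtain ⟨ret, hret, hret'⟩ := (MeasurableEmbedding.subtype_coe hY).exists_measurable_extend
    measurable_id fun _ => ‹Nonempty Y›
  refine ⟨fun x => ret (E x).toReal, hret.comp (measurable_ereal_toReal.comp hE), ?_,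
    ⟨⋃ q, J q, countable_iUnion hJ, ?_⟩, ?_⟩
  · intro r x hr
    simp only [E, hCsmul _ r x hr]
  · intro x y hxy
    have : E x = E y := iSup_congr fun q => by
      simp only [hCJ q x y (hxy.mono (subset_iUnion J q))]
    simp only [this]
  · have hae : ∀ᵐ s ∂μ, ∀ q : ℚ, (fun t => f t s) ∈ C q ↔ (q : ℝ) < s := by
      refine ae_all_iff.2 fun q => ?_
      have := measure_symmDiff_eq_zero_iff.1 (hAB q)
      filter_upwards [this.mem_iff] with s hs
      rw [hAC q] at hs
      exact hs
    filter_upwards [hae] with s hs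
    have hEs : E (fun t => f t s) = ((s : ℝ) : EReal) := by
      apply le_antisymm
      · refine iSup_le fun q => ?_
        split_ifs with h
        · exact EReal.coe_le_coe_iff.2 ((hs q).1 h).le
        · exact bot_le
      · refine le_of_forall_lt fun c hc => ?_
        obtain ⟨q, hq, hqs⟩ := EReal.lt_iff_exists_rat_btwn.1 hc
        refine hq.trans_le ?_
        have hqC := (hs q).2 (EReal.coe_lt_coe_iff.1 hqs)
        refine le_iSup_of_le q ?_
        rw [if_pos hqC]
    rw [hEs, EReal.toReal_coe]
    exact congrFun hret' s

/-- The scale uses a sequence attached to a function `f₀` of full support: if `L` vanishes at the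
vector of `s`, so does `f₀(s)`, a null event. Dependence of `Θ` on countably many coordinates is
kept for the uniqueness of the point map. -/
theorem exists_isDecoder (hα : 0 < α) {Y : Set ℝ} (hY : MeasurableSet Y) [Nonempty Y]
    {μ : Measure Y} {f : T → Y → ℝ≥0} (hf : ∀ t, Measurable (f t)) (hmin : IsMinimal α μ f) :
    ∃ Θ L, IsDecoder μ f Θ L ∧ ∃ J : Set T, J.Countable ∧ ∀ x y, EqOn x y J → Θ x = Θ y := by
  obtain ⟨Θ, h1, h2, h3, h4⟩ := exists_point_decoder hY hmin.ratio
  obtain ⟨f₀, hf₀, -, hsupp⟩ := hmin.support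
  obtain ⟨u, hu⟩ := exists_seq_of_mem_closedMaxSpan hα hf₀
  obtain ⟨L, hL, hLsmul, hL0⟩ := exists_homogeneous_scale u
  refine ⟨Θ, L, ⟨h1, hL, h2, hLsmul, ⟨u, hL0⟩, h4, ?_⟩, h3⟩
  have hfm : Measurable fun s t => f t s := measurable_pi_lambda _ hf
  have := hu {s | L (fun t => f t s) = 0} (hL.comp hfm (measurableSet_singleton 0))
    fun n => Eventually.of_forall fun s hs => (hL0 _).1 hs n
  filter_upwards [this, hsupp.mem_iff] with s h5 h6 h7
  exact h6.2 (mem_univ s) (h5 h7)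

end Span

/-! ### Max-linear cones and rigidity of isometries on them. -/

theorem edist_mul_left_nnreal (c x y : ℝ≥0) : edist (c * x) (c * y) = c * edist x y := by
  rw [edist_nndist, edist_nndist, ← ENNReal.coe_mul, NNReal.nndist_eq, NNReal.nndist_eq,
    ← mul_tsub, ← mul_tsub, mul_max]

theorem edist_max_max_le (a b c d : ℝ≥0) :
    edist (max a b) (max c d) ≤ edist a c + edist b d := by
  simp only [edist_nndist, ← ENNReal.coe_add, ENNReal.coe_le_coe, ← NNReal.coe_le_coe,
    NNReal.coe_add, coe_nndist, NNReal.dist_eq, NNReal.coe_max]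
  exact (abs_max_sub_max_le_max _ _ _ _).trans
    (max_le_add_of_nonneg (abs_nonneg _) (abs_nonneg _))

section Cone

variable {S₁ S₂ K T : Type*} [MeasurableSpace S₁] [MeasurableSpace S₂] {α : ℝ} {μ₁ : Measure S₁}
  {μ₂ : Measure S₂}

/-- Stability under the max-linear combinations `a₁ f₁ ∨ a₂ f₂`, `a₁ > 0`, `a₂ ≥ 0`. -/
def IsMaxCone {S : Type*} (F : Set (S → ℝ≥0)) : Prop :=
  ∀ f₁ ∈ F, ∀ f₂ ∈ F, ∀ a₁ a₂ : ℝ≥0, 0 < a₁ → (fun s => max (a₁ * f₁ s) (a₂ * f₂ s)) ∈ F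

theorem normPlus_eq_iff (hα : 0 < α) {φ : S₁ → ℝ≥0} {ψ : S₂ → ℝ≥0} :
    normPlus α μ₂ ψ = normPlus α μ₁ φ ↔
      ∫⁻ s, (ψ s : ℝ≥0∞) ^ α ∂μ₂ = ∫⁻ s, (φ s : ℝ≥0∞) ^ α ∂μ₁ :=
  (ENNReal.rpow_left_injective (one_div_pos.2 hα).ne').eq_iff

theorem isMaxCone_Lplus (hα : 0 < α) : IsMaxCone (Lplus α μ₁) := by
  intro f₁ h₁ f₂ h₂ a₁ a₂ _
  refine ⟨(h₁.1.const_mul _).max (h₂.1.const_mul _), ?_⟩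
  refine lt_of_le_of_lt (b := ∫⁻ s, ((a₁ : ℝ≥0∞) ^ α * (f₁ s : ℝ≥0∞) ^ α +
    (a₂ : ℝ≥0∞) ^ α * (f₂ s : ℝ≥0∞) ^ α) ∂μ₁) (lintegral_mono fun s => ?_) ?_
  · simp only [← ENNReal.mul_rpow_of_nonneg _ _ hα.le, ← ENNReal.coe_mul]
    rcases max_cases (a₁ * f₁ s) (a₂ * f₂ s) with h | h
    · rw [h.1]; exact le_self_add
    · rw [h.1]; exact le_add_self
  · rw [lintegral_add_left ((h₁.1.coe_nnreal_ennreal.pow_const α).const_mul _),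
      lintegral_const_mul _ (h₁.1.coe_nnreal_ennreal.pow_const α),
      lintegral_const_mul _ (h₂.1.coe_nnreal_ennreal.pow_const α)]
    exact ENNReal.add_lt_top.2
      ⟨ENNReal.mul_lt_top (ENNReal.rpow_lt_top_of_nonneg hα.le ENNReal.coe_ne_top) h₁.2,
        ENNReal.mul_lt_top (ENNReal.rpow_lt_top_of_nonneg hα.le ENNReal.coe_ne_top) h₂.2⟩

theorem isMaxCone_maxSpan {S : Type*} (f : T → S → ℝ≥0) : IsMaxCone (maxSpan f) := by
  classical
  rintro _ ⟨J, hJ, a, ha, rfl⟩ _ ⟨J', hJ', a', ha', rfl⟩ c c' hc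
  have hmul : ∀ (c : ℝ≥0) (J : Finset T) (a x : T → ℝ≥0), (c * J.sup fun t => a t * x t) =
      J.sup fun t => c * a t * x t := by
    intro c J a x
    rw [NNReal.mul_finset_sup]
    simp only [mul_assoc]
  rcases eq_or_ne c' 0 with rfl | hc'
  · exact ⟨J, hJ, fun t => c * a t, fun t ht => mul_pos hc (ha t ht), by simp [hmul]⟩
  · have hc'' := pos_iff_ne_zero.2 hc'
    refine ⟨J ∪ J', hJ.mono Finset.subset_union_left, fun t =>
      max (if t ∈ J then c * a t else 0) (if t ∈ J' then c' * a' t else 0), fun t ht => ?_, ?_⟩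
    · rcases Finset.mem_union.1 ht with h | h
      · exact lt_max_of_lt_left (by simpa [h] using mul_pos hc (ha t h))
      · exact lt_max_of_lt_right (by simpa [h] using mul_pos hc'' (ha' t h))
    · ext1 s
      simp only [hmul]
      rw [Finset.sup_union]
      have hsup : ∀ t, max (if t ∈ J then c * a t else 0) (if t ∈ J' then c' * a' t else 0) *
          f t s = (if t ∈ J then c * a t * f t s else 0) ⊔
            (if t ∈ J' then c' * a' t * f t s else 0) := by
        intro t
        rw [max_mul]
        split_ifs <;> simp
      simp only [hsup]
      apply le_antisymm
      · refine max_le (le_trans (Finset.sup_mono_fun fun t ht => ?_) le_sup_left)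
          (le_trans (Finset.sup_mono_fun fun t ht => ?_) le_sup_right)
        · rw [if_pos ht]; exact le_sup_left
        · rw [if_pos ht]; exact le_sup_right
      · have hle : ∀ t, (if t ∈ J then c * a t * f t s else 0) ⊔
            (if t ∈ J' then c' * a' t * f t s else 0) ≤
            max (J.sup fun t => c * a t * f t s) (J'.sup fun t => c' * a' t * f t s) := by
          refine fun t => sup_le ?_ ?_
          · split_ifs with h
            · exact (Finset.le_sup (f := fun t => c * a t * f t s) h).trans (le_max_left _ _)
            · exact zero_le
          · split_ifs with h
            · exact (Finset.le_sup (f := fun t => c' * a' t * f t s) h).trans (le_max_right _ _)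
            · exact zero_le
        exact sup_le (Finset.sup_le fun t _ => hle t) (Finset.sup_le fun t _ => hle t)

theorem rhoDist_max_le (hα : 0 < α) {φ₁ φ₂ ψ₁ ψ₂ : S₁ → ℝ≥0} (h₁ : Measurable φ₁)
    (h₂ : Measurable ψ₁) (h₃ : Measurable φ₂) (h₄ : Measurable ψ₂) (a₁ a₂ : ℝ≥0) :
    rhoDist α μ₁ (fun s => max (a₁ * ψ₁ s) (a₂ * ψ₂ s)) (fun s => max (a₁ * φ₁ s) (a₂ * φ₂ s)) ≤
      (a₁ ^ α : ℝ≥0) * rhoDist α μ₁ ψ₁ φ₁ + (a₂ ^ α : ℝ≥0) * rhoDist α μ₁ ψ₂ φ₂ := by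
  have hm₁ : Measurable fun s => edist (ψ₁ s ^ α) (φ₁ s ^ α) :=
    (h₂.pow_const α).edist (h₁.pow_const α)
  have hm₂ : Measurable fun s => edist (ψ₂ s ^ α) (φ₂ s ^ α) :=
    (h₄.pow_const α).edist (h₃.pow_const α)
  rw [rhoDist, rhoDist, rhoDist, ← lintegral_const_mul _ hm₁, ← lintegral_const_mul _ hm₂,
    ← lintegral_add_left (hm₁.const_mul _)]
  refine lintegral_mono fun s => ?_
  have hmax : ∀ x y : ℝ≥0, (max x y) ^ α = max (x ^ α) (y ^ α) := fun x y =>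
    (NNReal.monotone_rpow_of_nonneg hα.le).map_max
  simp only [hmax, NNReal.mul_rpow, ← edist_mul_left_nnreal]
  exact edist_max_max_le _ _ _ _

theorem measurable_of_mem_maxSpan {f : T → S₁ → ℝ≥0} (hf : ∀ t, Measurable (f t)) {ψ : S₁ → ℝ≥0}
    (hψ : ψ ∈ maxSpan f) : Measurable ψ := by
  obtain ⟨J, -, a, -, rfl⟩ := hψ
  exact measurable_finset_sup_mul hf J a

theorem isMaxCone_closedMaxSpan (hα : 0 < α) {f : T → S₁ → ℝ≥0} (hf : ∀ t, Measurable (f t)) :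
    IsMaxCone (closedMaxSpan α μ₁ f) := by
  intro φ₁ h₁ φ₂ h₂ a₁ a₂ ha₁
  refine ⟨isMaxCone_Lplus hα _ h₁.1 _ h₂.1 _ _ ha₁, fun ε hε => ?_⟩
  -- The added `1` keeps the tolerance meaningful when the coefficient is zero.
  have hpos : ∀ a : ℝ≥0, 0 < ε / 2 / ((a ^ α : ℝ≥0) + 1) := fun a =>
    ENNReal.div_pos (ENNReal.half_pos hε.ne').ne' (by finiteness)
  obtain ⟨ψ₁, hψ₁, hρ₁⟩ := h₁.2 _ (hpos a₁)
  obtain ⟨ψ₂, hψ₂, hρ₂⟩ := h₂.2 _ (hpos a₂)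
  refine ⟨_, isMaxCone_maxSpan f _ hψ₁ _ hψ₂ a₁ a₂ ha₁, ?_⟩
  refine (rhoDist_max_le hα h₁.1.1 (measurable_of_mem_maxSpan hf hψ₁) h₂.1.1
    (measurable_of_mem_maxSpan hf hψ₂) a₁ a₂).trans_lt ?_
  have hlt : ∀ (a : ℝ≥0) (r : ℝ≥0∞), r < ε / 2 / ((a ^ α : ℝ≥0) + 1) →
      (a ^ α : ℝ≥0) * r < ε / 2 := by
    intro a r hr
    refine lt_of_le_of_lt ?_ ((ENNReal.lt_div_iff_mul_lt (by simp) (by simp)).1 hr)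
    rw [mul_comm]
    gcongr
    exact le_self_add
  calc _ < ε / 2 + ε / 2 := ENNReal.add_lt_add (hlt _ _ hρ₁) (hlt _ _ hρ₂)
    _ = ε := ENNReal.add_halves ε

theorem mem_closedMaxSpan {f : T → S₁ → ℝ≥0} (hf : ∀ t, f t ∈ Lplus α μ₁) (t : T) :
    f t ∈ closedMaxSpan α μ₁ f :=
  ⟨hf t, fun ε hε => ⟨f t, ⟨{t}, by simp, 1, by simp, by simp⟩, by simpa [rhoDist] using hε⟩⟩

/-- Membership in `F` is part of the induction, since `U` is max-linear only on `F`. The second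
coefficient is `0` for a single term and `1` when a term is added. -/
theorem IsMaxLinearIsometry.map_sup {F : Set (S₁ → ℝ≥0)} {G : Set (S₂ → ℝ≥0)}
    {U : (S₁ → ℝ≥0) → S₂ → ℝ≥0} (hU : IsMaxLinearIsometry α μ₁ μ₂ F G U) (hF : IsMaxCone F)
    {f : K → S₁ → ℝ≥0} {g : K → S₂ → ℝ≥0} (hf : ∀ k, f k ∈ F) (hfg : ∀ k, U (f k) =ᵐ[μ₂] g k)
    (J : Finset K) (a : K → ℝ≥0) (hJ : J.Nonempty) (ha : ∀ k ∈ J, 0 < a k) :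
    (fun s => J.sup fun k => a k * f k s) ∈ F ∧
      U (fun s => J.sup fun k => a k * f k s) =ᵐ[μ₂] fun s => J.sup fun k => a k * g k s := by
  induction hJ using Finset.Nonempty.cons_induction with
  | singleton k =>
    have h1 := hF _ (hf k) _ (hf k) (a k) 0 (ha k (by simp))
    have h2 := hU.maxLinear _ (hf k) _ (hf k) (a k) 0
    simp only [zero_mul, max_eq_left zero_le] at h1 h2
    simp only [Finset.sup_singleton]
    refine ⟨h1, h2.trans ((hfg k).mono fun s hs => ?_)⟩
    simp only [hs]
  | cons k J hk hJ ih =>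
    obtain ⟨h3, h4⟩ := ih fun j hj => ha j (Finset.mem_cons_of_mem hj)
    have h1 := hF _ (hf k) _ h3 (a k) 1 (ha k (by simp))
    have h2 := hU.maxLinear _ (hf k) _ h3 (a k) 1
    simp only [one_mul] at h1 h2
    simp only [Finset.sup_cons]
    refine ⟨h1, h2.trans ?_⟩
    filter_upwards [hfg k, h4] with s h5 h6
    rw [h5, h6]

theorem IsMaxLinearIsometry.sameNorms {F : Set (S₁ → ℝ≥0)} {G : Set (S₂ → ℝ≥0)}
    {U : (S₁ → ℝ≥0) → S₂ → ℝ≥0} (hU : IsMaxLinearIsometry α μ₁ μ₂ F G U) (hα : 0 < α)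
    (hF : IsMaxCone F) {f : K → S₁ → ℝ≥0} {g : K → S₂ → ℝ≥0} (hf : ∀ k, f k ∈ F)
    (hFL : F ⊆ Lplus α μ₁) (hg : ∀ k, g k ∈ Lplus α μ₂) (hfg : ∀ k, U (f k) =ᵐ[μ₂] g k) :
    SameNorms α μ₁ μ₂ f g where
  left_mem k := hFL (hf k)
  right_mem := hg
  norms J a hJ ha := by
    obtain ⟨h1, h2⟩ := hU.map_sup hF hf hfg J a hJ ha
    rw [← (normPlus_eq_iff hα).1 (hU.norm_eq _ h1)]
    exact lintegral_congr_ae (h2.mono fun s hs => by simp only [hs])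

/-- Serves both uniqueness claims, with `F` the closed span for the relating isometry and with `F`
all of `Lplus` for its extension. -/
theorem IsMaxLinearIsometry.ae_eq_transport {F : Set (S₁ → ℝ≥0)} {G : Set (S₂ → ℝ≥0)}
    {U : (S₁ → ℝ≥0) → S₂ → ℝ≥0} (hU : IsMaxLinearIsometry α μ₁ μ₂ F G U) (hα : 0 < α)
    (hF : IsMaxCone F) (hFL : F ⊆ Lplus α μ₁) (hGL : G ⊆ Lplus α μ₂) {f : K → S₁ → ℝ≥0}
    {g : K → S₂ → ℝ≥0} {Θ : (K → ℝ≥0) → S₁} {L : (K → ℝ≥0) → ℝ≥0} (hd : IsDecoder μ₁ f Θ L)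
    (hf : ∀ k, f k ∈ F) (hg : ∀ k, g k ∈ Lplus α μ₂) (hfg : ∀ k, U (f k) =ᵐ[μ₂] g k)
    {φ : S₁ → ℝ≥0} (hφ : φ ∈ F) : U φ =ᵐ[μ₂] transport f g Θ L φ := by
  refine hd.ae_eq_transport_of_consFamily hα (hU.sameNorms hα hF ?_ hFL ?_ ?_)
  · rintro (_ | k)
    exacts [hφ, hf k]
  · rintro (_ | k)
    exacts [hGL (hU.mapsTo hφ), hg k]
  · rintro (_ | k)
    exacts [Filter.EventuallyEq.rfl, hfg k]

end Cone

/-! ### Weighted composition operators are max-linear isometries. -/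

section WeightedComp

variable {S₁ S₂ T : Type*} [MeasurableSpace S₁] [MeasurableSpace S₂] {α : ℝ} {μ₁ : Measure S₁}
  {μ₂ : Measure S₂} {A : Set S₂} {Φ : S₂ → S₁} {h : S₂ → ℝ≥0}

theorem lintegral_weighted_comp (hA : MeasurableSet A) (hΦ : Measurable Φ) (hh : Measurable h)
    (hμ : μ₁ = ((μ₂.restrict A).withDensity fun s => (h s : ℝ≥0∞) ^ α).map Φ)
    {H : S₁ → ℝ≥0∞} (hH : Measurable H) :
    ∫⁻ s, A.indicator (fun s => (h s : ℝ≥0∞) ^ α * H (Φ s)) s ∂μ₂ = ∫⁻ s, H s ∂μ₁ := by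
  rw [hμ, lintegral_map hH hΦ, lintegral_withDensity_eq_lintegral_mul _
    (hh.coe_nnreal_ennreal.pow_const α) (show Measurable fun s => H (Φ s) from hH.comp hΦ),
    lintegral_indicator hA]
  rfl

theorem lintegral_rpow_weighted_comp (hα : 0 < α) (hA : MeasurableSet A) (hΦ : Measurable Φ)
    (hh : Measurable h) (hμ : μ₁ = ((μ₂.restrict A).withDensity fun s => (h s : ℝ≥0∞) ^ α).map Φ)
    {φ : S₁ → ℝ≥0} (hφ : Measurable φ) :
    ∫⁻ s, ((A.indicator (fun s => h s * φ (Φ s)) s : ℝ≥0) : ℝ≥0∞) ^ α ∂μ₂ =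
      ∫⁻ s, (φ s : ℝ≥0∞) ^ α ∂μ₁ := by
  classical
  rw [← lintegral_weighted_comp hA hΦ hh hμ (hφ.coe_nnreal_ennreal.pow_const α)]
  refine lintegral_congr fun s => ?_
  by_cases hs : s ∈ A
  · simp [hs, ENNReal.mul_rpow_of_nonneg _ _ hα.le]
  · simp [hs, hα]

theorem weighted_comp_mem_Lplus (hα : 0 < α) (hA : MeasurableSet A) (hΦ : Measurable Φ)
    (hh : Measurable h) (hμ : μ₁ = ((μ₂.restrict A).withDensity fun s => (h s : ℝ≥0∞) ^ α).map Φ)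
    {φ : S₁ → ℝ≥0} (hφ : φ ∈ Lplus α μ₁) :
    (A.indicator fun s => h s * φ (Φ s)) ∈ Lplus α μ₂ :=
  ⟨(hh.mul (hφ.1.comp hΦ)).indicator hA, by
    rw [lintegral_rpow_weighted_comp hα hA hΦ hh hμ hφ.1]; exact hφ.2⟩

theorem rhoDist_weighted_comp (hα : 0 < α) (hA : MeasurableSet A) (hΦ : Measurable Φ)
    (hh : Measurable h) (hμ : μ₁ = ((μ₂.restrict A).withDensity fun s => (h s : ℝ≥0∞) ^ α).map Φ)
    {φ ψ : S₁ → ℝ≥0} (hφ : Measurable φ) (hψ : Measurable ψ) :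
    rhoDist α μ₂ (A.indicator fun s => h s * φ (Φ s)) (A.indicator fun s => h s * ψ (Φ s)) =
      rhoDist α μ₁ φ ψ := by
  classical
  rw [rhoDist, rhoDist, ← lintegral_weighted_comp hA hΦ hh hμ
    ((hφ.pow_const α).edist (hψ.pow_const α))]
  refine lintegral_congr fun s => ?_
  by_cases hs : s ∈ A
  · simp [hs, NNReal.mul_rpow, edist_mul_left_nnreal, ENNReal.coe_rpow_of_nonneg _ hα.le]
  · simp [hs]

theorem isMaxLinearIsometry_weighted_comp (hα : 0 < α) (hA : MeasurableSet A) (hΦ : Measurable Φ)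
    (hh : Measurable h) (hμ : μ₁ = ((μ₂.restrict A).withDensity fun s => (h s : ℝ≥0∞) ^ α).map Φ) :
    IsMaxLinearIsometry α μ₁ μ₂ (Lplus α μ₁) (Lplus α μ₂)
      fun φ => A.indicator fun s => h s * φ (Φ s) where
  mapsTo φ hφ := weighted_comp_mem_Lplus hα hA hΦ hh hμ hφ
  maxLinear f₁ _ f₂ _ a₁ a₂ := Eventually.of_forall fun s => by
    classical
    by_cases hs : s ∈ A
    · simp only [indicator_of_mem hs, mul_max]
      congr 1 <;> ring
    · simp [hs]
  norm_eq φ hφ := (normPlus_eq_iff hα).2 (lintegral_rpow_weighted_comp hα hA hΦ hh hμ hφ.1)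

/-- The operator preserves `ρ` and sends a combination of the `f_t` to the same combination of the
`g_t`, so approximants go to approximants. -/
theorem weighted_comp_mem_closedMaxSpan (hα : 0 < α) (hA : MeasurableSet A) (hΦ : Measurable Φ)
    (hh : Measurable h) (hμ : μ₁ = ((μ₂.restrict A).withDensity fun s => (h s : ℝ≥0∞) ^ α).map Φ)
    {f : T → S₁ → ℝ≥0} {g : T → S₂ → ℝ≥0} (hf : ∀ t, Measurable (f t))
    (hg : ∀ t, g t =ᵐ[μ₂] A.indicator fun s => h s * f t (Φ s)) {φ : S₁ → ℝ≥0}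
    (hφ : φ ∈ closedMaxSpan α μ₁ f) :
    (A.indicator fun s => h s * φ (Φ s)) ∈ closedMaxSpan α μ₂ g := by
  refine ⟨weighted_comp_mem_Lplus hα hA hΦ hh hμ hφ.1, fun ε hε => ?_⟩
  obtain ⟨ψ, hψ, hρ⟩ := hφ.2 ε hε
  have hψm := measurable_of_mem_maxSpan hf hψ
  obtain ⟨J, hJ, a, ha, rfl⟩ := hψ
  refine ⟨_, ⟨J, hJ, a, ha, rfl⟩, ?_⟩
  rw [← rhoDist_weighted_comp hα hA hΦ hh hμ hψm hφ.1.1] at hρ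
  refine lt_of_le_of_lt (le_of_eq (lintegral_congr_ae ?_)) hρ
  filter_upwards [(Finset.eventually_all J).2 fun t _ => hg t] with s hs
  have : (J.sup fun t => a t * g t s) =
      A.indicator (fun s => h s * J.sup fun t => a t * f t (Φ s)) s := by
    rw [Finset.sup_congr rfl fun t ht => by rw [hs t ht]]
    by_cases hsA : s ∈ A
    · simp only [indicator_of_mem hsA, NNReal.mul_finset_sup]
      exact Finset.sup_congr rfl fun t _ => by ring
    · simp only [indicator_of_notMem hsA, mul_zero]
      exact le_antisymm (Finset.sup_le fun _ _ => le_rfl) zero_le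
  simp only [this]

theorem IsSupport.ae_eq {f : T → S₁ → ℝ≥0} {A B : Set S₁} (hA : IsSupport α μ₁ f A)
    (hB : IsSupport α μ₁ f B) : A =ᵐ[μ₁] B := by
  obtain ⟨a, ha, ha', hA⟩ := hA
  obtain ⟨b, hb, hb', hB⟩ := hB
  exact hA.symm.trans ((((ae_le_set.2 (hb' a ha)).antisymm (ae_le_set.2 (ha' b hb)))).trans hB)

end WeightedComp

/-! ### Making the point map surjective by a null-set modification. -/

section Surjectivity

variable {S : Type*} [MeasurableSpace S]

/-- An uncountable Borel set is Borel isomorphic to the plane. The vertical lines are uncountably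
many disjoint uncountable sets, and a σ-finite measure charges only countably many of them. -/
theorem exists_uncountable_null_subset [StandardBorelSpace S] (μ : Measure S) [SigmaFinite μ]
    {A : Set S} (hA : MeasurableSet A) (hunc : ¬ A.Countable) :
    ∃ B ⊆ A, MeasurableSet B ∧ ¬ B.Countable ∧ μ B = 0 := by
  have : StandardBorelSpace A := hA.standardBorel
  have hreal : ¬ Countable ℝ := fun h => Cardinal.not_countable_real (countable_univ_iff.2 h)
  have hprod : ¬ Countable (ℝ × ℝ) := fun h =>
    hreal (Function.Injective.countable (f := fun x : ℝ => (x, x)) fun x y h => (Prod.ext_iff.1 h).1)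
  let e : ℝ × ℝ ≃ᵐ A := PolishSpace.measurableEquivOfNotCountable hprod hunc
  let em : ℝ × ℝ → S := fun p => e p
  have hem : MeasurableEmbedding em :=
    (MeasurableEmbedding.subtype_coe hA).comp e.measurableEmbedding
  let B : ℝ → Set S := fun y => em '' ({y} ×ˢ univ)
  have hB : ∀ y, MeasurableSet (B y) := fun y =>
    hem.measurableSet_image.2 ((measurableSet_singleton y).prod .univ)
  have hdisj : Pairwise (Function.onFun Disjoint B) := by
    intro y z hyz
    refine (disjoint_image_iff hem.injective).2 (Set.disjoint_left.2 fun p h1 h2 => hyz ?_)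
    exact (h1.1 : p.1 = y).symm.trans (h2.1 : p.1 = z)
  have hcount := Measure.countable_meas_pos_of_disjoint_iUnion (μ := μ) hB hdisj
  obtain ⟨y, hy⟩ : ∃ y, y ∉ {y | 0 < μ (B y)} := by
    by_contra! hall
    exact Cardinal.not_countable_real (hcount.mono fun y _ => hall y)
  refine ⟨B y, ?_, hB y, fun hc => ?_, by simpa using hy⟩
  · rintro _ ⟨p, -, rfl⟩
    exact (e p).2
  · refine Cardinal.not_countable_real ((hc.preimage_of_injOn
      (f := fun x : ℝ => em (y, x)) fun a _ b _ hab => ?_).mono fun x _ => ?_)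
    · exact (Prod.ext_iff.1 (hem.injective hab)).2
    · exact ⟨(y, x), by simp, rfl⟩

theorem stdMeasure_apply (I : Fin 2) (N : ℕ∞) (B : Set (stdSupport I N)) :
    stdMeasure I N B = ((volume : Measure ℝ).restrict (Ioo 0 1) +
      (Measure.count : Measure ℝ).restrict (range ((↑) : ℕ → ℝ))) (Subtype.val '' B) :=
  (MeasurableEmbedding.subtype_coe (measurableSet_stdSupport I N)).comap_apply _ _

theorem stdMeasure_compl_ne_zero {N : ℕ∞} {C : Set (stdSupport 1 N)} (hC : C.Countable) :
    stdMeasure 1 N Cᶜ ≠ 0 := by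
  intro h0
  rw [stdMeasure_apply, Measure.add_apply, add_eq_zero] at h0
  have h1 : volume (Subtype.val '' Cᶜ ∩ Ioo (0 : ℝ) 1) = 0 :=
    le_antisymm ((Measure.le_restrict_apply _ _).trans h0.1.le) zero_le
  have h2 : volume (Subtype.val '' C : Set ℝ) = 0 := (hC.image _).measure_zero _
  have h3 : Ioo (0 : ℝ) 1 ⊆ (Subtype.val '' Cᶜ ∩ Ioo (0 : ℝ) 1) ∪ Subtype.val '' C := by
    intro x hx
    have hxS : x ∈ stdSupport 1 N := Or.inl ⟨rfl, hx⟩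
    by_cases hxC : (⟨x, hxS⟩ : stdSupport 1 N) ∈ C
    · exact Or.inr ⟨_, hxC, rfl⟩
    · exact Or.inl ⟨⟨_, hxC, rfl⟩, hx⟩
  have := measure_mono_null h3 (measure_union_null h1 h2)
  simp at this

theorem stdMeasure_singleton_ne_zero {N : ℕ∞} (p : stdSupport 0 N) : stdMeasure 0 N {p} ≠ 0 := by
  intro h0
  rw [stdMeasure_apply, Measure.add_apply, add_eq_zero, image_singleton,
    Measure.restrict_apply (measurableSet_singleton _)] at h0
  obtain ⟨n, -, -, hn⟩ : ∃ n : ℕ, 1 ≤ n ∧ (n : ℕ∞) ≤ N ∧ (p : ℝ) = n :=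
    p.2.resolve_left fun h => by simpa using h.1
  have h1 := h0.2
  rw [Measure.restrict_apply (measurableSet_singleton _),
    inter_eq_left.2 (singleton_subset_iff.2 (mem_range.2 ⟨n, hn.symm⟩))] at h1
  simp at h1

theorem not_countable_stdSupport_one (N : ℕ∞) : ¬ Countable (stdSupport 1 N) := fun h => by
  have := stdMeasure_compl_ne_zero (N := N) (C := univ) countable_univ
  simp at this

/-- A measurable map that meets every set of positive measure becomes surjective after a change
on a null set. -/
theorem exists_surjOn_ae_eq [StandardBorelSpace S] (μ : Measure S) [SigmaFinite μ] {I : Fin 2}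
    {N : ℕ∞} {A : Set S} (hA : MeasurableSet A) {Φ : S → stdSupport I N} (hΦ : Measurable Φ)
    (hmeet : ∀ B, MeasurableSet B → stdMeasure I N B ≠ 0 → (A ∩ Φ ⁻¹' B).Nonempty) :
    ∃ Φ' : S → stdSupport I N, Measurable Φ' ∧ SurjOn Φ' A univ ∧ Φ' =ᵐ[μ] Φ := by
  classical
  have hI : I = 0 ∨ I = 1 := by omega
  rcases hI with rfl | rfl
  -- Without the interval every point is an atom, so `Φ` is already onto.
  · refine ⟨Φ, hΦ, fun p _ => ?_, .rfl⟩
    obtain ⟨s, hs, hsp⟩ := hmeet {p} (measurableSet_singleton p) (stdMeasure_singleton_ne_zero p)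
    exact ⟨s, hs, hsp⟩
  -- With the interval, a countable `A` would have a countable image, whose complement has positive
  -- measure and would be missed. So `A` has an uncountable null Borel part, on which `Φ` is
  -- replaced by a Borel isomorphism onto the target.
  · have hunc : ¬ A.Countable := fun hc => by
      have hc' : (Φ '' A).Countable := hc.image Φ
      obtain ⟨s, hs, hsp⟩ := hmeet (Φ '' A)ᶜ hc'.measurableSet.compl (stdMeasure_compl_ne_zero hc')
      exact hsp ⟨s, hs, rfl⟩
    obtain ⟨B, hBA, hB, hBc, hB0⟩ := exists_uncountable_null_subset μ hA hunc
    have : StandardBorelSpace B := hB.standardBorel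
    have : StandardBorelSpace (stdSupport 1 N) := (measurableSet_stdSupport 1 N).standardBorel
    let e : B ≃ᵐ stdSupport 1 N :=
      PolishSpace.measurableEquivOfNotCountable hBc (not_countable_stdSupport_one N)
    obtain ⟨e', he', hee'⟩ := (MeasurableEmbedding.subtype_coe hB).exists_measurable_extend
      e.measurable fun s => ⟨Φ s⟩
    refine ⟨B.piecewise e' Φ, he'.piecewise hB hΦ, fun p _ => ?_, ?_⟩
    · refine ⟨e.symm p, hBA (e.symm p).2, ?_⟩
      rw [piecewise_eq_of_mem _ _ _ (e.symm p).2]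
      simpa using congrFun hee' (e.symm p)
    · filter_upwards [measure_eq_zero_iff_ae_notMem.1 hB0] with s hs
      exact piecewise_eq_of_notMem _ _ _ hs

end Surjectivity

/-! ### Supports, point representations and uniqueness of the point map. -/

section Representation

variable {S S₁ T : Type*} [MeasurableSpace S] [MeasurableSpace S₁] {α : ℝ} {μ₁ : Measure S₁}
  {μ : Measure S} {f : T → S₁ → ℝ≥0} {g : T → S → ℝ≥0}

/-- The image of a full-support `f₀` works: `f₀ ∘ Φ ≠ 0` a.e. on `A` because `μ₁` is the image of a
measure equivalent to `μ` on `A`, while every member of the span vanishes off `A` with the `g_t`. -/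
theorem isSupport_weighted_comp (hα : 0 < α) {A : Set S} (hA : MeasurableSet A) {Φ : S → S₁}
    {h : S → ℝ≥0} (hf : ∀ t, Measurable (f t)) (hrep : IsPointRep α μ₁ μ f g A Φ h)
    (hsupp : IsSupport α μ₁ f univ) : IsSupport α μ g A := by
  classical
  obtain ⟨f₀, hf₀, -, hf₀'⟩ := hsupp
  refine ⟨_, weighted_comp_mem_closedMaxSpan hα hA hrep.measurable_map hrep.measurable_factor
    hrep.measure_eq hf hrep.eq_comp hf₀, fun ψ hψ => ?_, ?_⟩
  all_goals
    have hne : ∀ᵐ s ∂μ, s ∈ A → f₀ (Φ s) ≠ 0 := by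
      have h1 : ∀ᵐ p ∂μ₁, f₀ p ≠ 0 := hf₀'.mem_iff.mono fun p hp => hp.2 (mem_univ p)
      rw [hrep.measure_eq] at h1
      have h2 := ae_of_ae_map hrep.measurable_map.aemeasurable h1
      rw [ae_withDensity_iff (hrep.measurable_factor.coe_nnreal_ennreal.pow_const α),
        ae_restrict_iff' hA] at h2
      refine h2.mono fun s hs hsA => hs hsA ?_
      simp [ENNReal.rpow_eq_zero_iff, (hrep.factor_pos s).ne', hα.not_gt]
  · obtain ⟨u, hu⟩ := exists_seq_of_mem_closedMaxSpan hα hψ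
    have h3 := hu Aᶜ hA.compl fun n => (hrep.eq_comp (u n)).mono fun s hs hsA => by
      rw [hs, indicator_of_notMem hsA]
    rw [measure_eq_zero_iff_ae_notMem]
    filter_upwards [h3, hne] with s h4 h5 h6
    have hsA : s ∈ A := by
      by_contra hsA
      exact h6.1 (h4 hsA)
    refine h6.2 ?_
    simp only [mem_ofPred_eq, indicator_of_mem hsA]
    exact mul_ne_zero (hrep.factor_pos s).ne' (h5 hsA)
  · refine eventuallyEq_set.2 (hne.mono fun s hs => ⟨fun hs' => ?_, fun hsA => ?_⟩)
    · by_contra hsA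
      exact hs' (indicator_of_notMem hsA _)
    · simp only [mem_ofPred_eq, indicator_of_mem hsA]
      exact mul_ne_zero (hrep.factor_pos s).ne' (hs hsA)

theorem IsPointRep.congr {A A' : Set S} {Φ Φ' : S → S₁} {h : S → ℝ≥0}
    (hrep : IsPointRep α μ₁ μ f g A Φ h) (hA : A =ᵐ[μ] A') (hΦ' : Measurable Φ')
    (hΦ : Φ' =ᵐ[μ] Φ) : IsPointRep α μ₁ μ f g A' Φ' h where
  measurable_map := hΦ'
  measurable_factor := hrep.measurable_factor
  factor_pos := hrep.factor_pos
  eq_comp t := by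
    classical
    filter_upwards [hrep.eq_comp t, hA.mem_iff, hΦ] with s h1 h2 h3
    simp only [h1, indicator_apply, h2, h3]
  measure_eq := by
    rw [← Measure.restrict_congr_set hA, Measure.map_congr (g := Φ)]
    · exact hrep.measure_eq
    · exact (withDensity_absolutelyContinuous _ _).ae_le (ae_restrict_of_ae hΦ)

theorem IsDecoder.isPointRep (hα : 0 < α) {Θ : (T → ℝ≥0) → S₁} {L : (T → ℝ≥0) → ℝ≥0}
    (hd : IsDecoder μ₁ f Θ L) (h : SameNorms α μ₁ μ f g) :
    IsPointRep α μ₁ μ f g {s | L (fun t => g t s) ≠ 0} (fun s => Θ fun t => g t s)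
      (fun s => decodedFactor f Θ L fun t => g t s) := by
  have hg : Measurable fun s t => g t s := measurable_pi_lambda _ fun t => (h.right_mem t).1
  exact {
    measurable_map := hd.measurable_point.comp hg
    measurable_factor := (hd.measurable_decodedFactor fun t => (h.left_mem t).1).comp hg
    factor_pos := fun s => decodedFactor_pos _ _ _ _
    eq_comp := hd.ae_eq_transport hα h
    measure_eq := hd.measure_eq hα h }

/-- On `A`, scale invariance gives `Θ(g) = Θ(h (f ∘ Φ)) = Θ(f ∘ Φ) = Φ`. As `T` may be uncountable,
the a.e. relations for the `g_t` hold simultaneously only along a countable set, which is why `Θ`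
must depend on the coordinates in `J` alone. -/
theorem IsPointRep.ae_eq_decoded (hα : 0 < α) {Θ : (T → ℝ≥0) → S₁} {L : (T → ℝ≥0) → ℝ≥0}
    (hd : IsDecoder μ₁ f Θ L) {J : Set T} (hJ : J.Countable)
    (hΘJ : ∀ x y, EqOn x y J → Θ x = Θ y) {A : Set S} (hA : MeasurableSet A) {Φ : S → S₁}
    {h : S → ℝ≥0} (hrep : IsPointRep α μ₁ μ f g A Φ h) :
    Φ =ᵐ[μ.restrict A] fun s => Θ fun t => g t s := by
  have h1 := hd.point_eq
  rw [hrep.measure_eq] at h1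
  have h2 := ae_of_ae_map hrep.measurable_map.aemeasurable h1
  rw [ae_withDensity_iff (hrep.measurable_factor.coe_nnreal_ennreal.pow_const α)] at h2
  have h3 : ∀ᵐ s ∂μ, ∀ t ∈ J, g t s = A.indicator (fun s => h s * f t (Φ s)) s :=
    (ae_ball_iff hJ).2 fun t _ => hrep.eq_comp t
  filter_upwards [h2, ae_restrict_of_ae h3, ae_restrict_mem hA] with s h4 h5 hsA
  have h6 := h4 (by simp [ENNReal.rpow_eq_zero_iff, (hrep.factor_pos s).ne', hα.not_gt])
  rw [← h6, ← hd.point_smul (h s) _ (hrep.factor_pos s)]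
  refine hΘJ _ _ fun t ht => ?_
  rw [h5 t ht, indicator_of_mem hsA]
  rfl

end Representation

/-- The conclusions about the relating isometry, from equality of the norms of all max-linear
combinations. -/
theorem relatingIsometry_of_sameNorms {T S : Type*} [MeasurableSpace S] [StandardBorelSpace S]
    {α : ℝ} (hα : 0 < α) {I : Fin 2} {N : ℕ∞} [Nonempty (stdSupport I N)]
    {f : T → stdSupport I N → ℝ≥0} (hmin : IsMinimal α (stdMeasure I N) f)
    {μ : Measure S} [SigmaFinite μ] {g : T → S → ℝ≥0} (hfg : SameNorms α (stdMeasure I N) μ f g) :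
    (∃ U, IsRelatingIsometry α (stdMeasure I N) μ f g U ∧
      ∀ U', IsRelatingIsometry α (stdMeasure I N) μ f g U' →
        ∀ φ ∈ closedMaxSpan α (stdMeasure I N) f, U' φ =ᵐ[μ] U φ) ∧
    (∃ A : Set S, MeasurableSet A ∧ IsSupport α μ g A) ∧
    ∀ U, IsRelatingIsometry α (stdMeasure I N) μ f g U →
      ∃ V, IsIsometryExtension α (stdMeasure I N) μ f U V ∧
        (∀ V', IsIsometryExtension α (stdMeasure I N) μ f U V' →
          ∀ φ ∈ Lplus α (stdMeasure I N), V' φ =ᵐ[μ] V φ) ∧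
        ∀ A : Set S, MeasurableSet A → IsSupport α μ g A →
          ∃ (Φ : S → stdSupport I N) (h : S → ℝ≥0),
            IsPointRep α (stdMeasure I N) μ f g A Φ h ∧
            SurjOn Φ A univ ∧
            (∀ φ ∈ Lplus α (stdMeasure I N), V φ =ᵐ[μ] A.indicator fun s => h s * φ (Φ s)) ∧
            ∀ Φ' h', IsPointRep α (stdMeasure I N) μ f g A Φ' h' → Φ' =ᵐ[μ.restrict A] Φ := by
  classical
  have hfm := fun t => (hfg.left_mem t).1
  obtain ⟨Θ, L, hd, J, hJ, hΘJ⟩ := exists_isDecoder hα (measurableSet_stdSupport I N) hfm hmin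
  have hrep := hd.isPointRep hα hfg
  have hgm : Measurable fun s t => g t s := measurable_pi_lambda _ fun t => (hfg.right_mem t).1
  have hA₀ : MeasurableSet {s | L (fun t => g t s) ≠ 0} :=
    (hd.measurable_scale.comp hgm (measurableSet_singleton 0)).compl
  have hsupp := isSupport_weighted_comp hα hA₀ hfm hrep hmin.support
  have hV : IsMaxLinearIsometry α (stdMeasure I N) μ (Lplus α (stdMeasure I N)) (Lplus α μ)
      (transport f g Θ L) :=
    isMaxLinearIsometry_weighted_comp hα hA₀ hrep.measurable_map hrep.measurable_factor
      hrep.measure_eq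
  have hcl : closedMaxSpan α (stdMeasure I N) f ⊆ Lplus α (stdMeasure I N) := fun φ hφ => hφ.1
  have huniq : ∀ U, IsRelatingIsometry α (stdMeasure I N) μ f g U →
      ∀ φ ∈ closedMaxSpan α (stdMeasure I N) f, U φ =ᵐ[μ] transport f g Θ L φ :=
    fun U hU φ hφ => hU.toIsMaxLinearIsometry.ae_eq_transport hα (isMaxCone_closedMaxSpan hα hfm)
      hcl (fun ψ hψ => hψ.1) hd (mem_closedMaxSpan hfg.left_mem) hfg.right_mem hU.map_eq hφ
  refine ⟨⟨transport f g Θ L, ⟨⟨fun φ hφ => ?_, ?_, ?_⟩, ?_⟩, huniq⟩, ⟨_, hA₀, hsupp⟩,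
    fun U hU => ⟨transport f g Θ L, ⟨hV, fun φ hφ => (huniq U hU φ hφ).symm⟩, ?_, ?_⟩⟩
  · exact weighted_comp_mem_closedMaxSpan hα hA₀ hrep.measurable_map hrep.measurable_factor
      hrep.measure_eq hfm hrep.eq_comp hφ
  · exact fun f₁ h₁ f₂ h₂ => hV.maxLinear f₁ (hcl h₁) f₂ (hcl h₂)
  · exact fun φ hφ => hV.norm_eq φ (hcl hφ)
  · exact fun t => (hrep.eq_comp t).symm
  · intro V' hV' φ hφ
    exact hV'.toIsMaxLinearIsometry.ae_eq_transport hα (isMaxCone_Lplus hα) subset_rfl subset_rfl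
      hd hfg.left_mem hfg.right_mem
      (fun t => (hV'.extends_eq _ (mem_closedMaxSpan hfg.left_mem t)).trans (hU.map_eq t)) hφ
  · intro A hA hAsupp
    have hAA := hsupp.ae_eq hAsupp
    have hrepA := hrep.congr hAA hrep.measurable_map .rfl
    -- A measurable set that the point map misses on `A` is null for the image measure, which is
    -- `stdMeasure I N`.
    obtain ⟨Φ, hΦ, hsurj, hΦeq⟩ := exists_surjOn_ae_eq μ hA hrepA.measurable_map
      fun B hB hB0 => by
        by_contra hempty
        rw [not_nonempty_iff_eq_empty, inter_comm] at hempty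
        refine hB0 ?_
        rw [hrepA.measure_eq, Measure.map_apply hrepA.measurable_map hB]
        refine withDensity_absolutelyContinuous _ _ ?_
        rw [Measure.restrict_apply (hrepA.measurable_map hB), hempty, measure_empty]
    refine ⟨Φ, _, hrepA.congr .rfl hΦ hΦeq, hsurj, fun φ _ => ?_, fun Φ' h' hrep' => ?_⟩
    · filter_upwards [hAA.mem_iff, hΦeq] with s h1 h2
      rw [transport]
      simp only [indicator_apply, mem_ofPred_eq, h1, h2]
    · exact (hrep'.ae_eq_decoded hα hd hJ hΘJ hA).trans (ae_restrict_of_ae hΦeq.symm)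

/-! ### Joint laws of extremal integrals. -/

theorem nnreal_coe_le_add_edist (a b : ℝ≥0) : (a : ℝ≥0∞) ≤ b + edist a b := by
  rw [edist_nndist, ← ENNReal.coe_add, ENNReal.coe_le_coe, NNReal.nndist_eq]
  exact tsub_le_iff_left.1 (le_max_left _ _)

theorem ennreal_le_add_edist (a b : ℝ≥0∞) : a ≤ b + edist a b := by
  rcases eq_or_ne b ∞ with rfl | hb
  · simp
  rcases eq_or_ne a ∞ with rfl | ha
  · rw [(ENNReal.edist_eq_top_iff _ _).2 ⟨hb.symm, Or.inl rfl⟩]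
    simp
  · lift a to ℝ≥0 using ha
    lift b to ℝ≥0 using hb
    exact nnreal_coe_le_add_edist a b

section SupMeasure

variable {S Ω : Type*} [MeasurableSpace S] [MeasurableSpace Ω] {α : ℝ} {μ : Measure S}
  {P : Measure Ω} [IsProbabilityMeasure P] {M : Set S → Ω → ℝ≥0∞}

theorem IsFrechetSupMeasure.ae_eq_zero (hM : IsFrechetSupMeasure α μ P M) {A : Set S}
    (hA : MeasurableSet A) (h0 : μ A = 0) : ∀ᵐ ω ∂P, M A ω = 0 := by
  have h1 : ∀ n : ℕ, ∀ᵐ ω ∂P, M A ω ≤ ENNReal.ofReal ((n : ℝ) + 1)⁻¹ := by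
    intro n
    have := hM.law_of_lt_top A hA (by simp [h0]) ((n : ℝ) + 1)⁻¹ (by positivity)
    simp only [h0, ENNReal.toReal_zero, zero_mul, neg_zero, Real.exp_zero,
      ENNReal.ofReal_one] at this
    exact (mem_ae_iff_prob_eq_one (measurableSet_le (hM.measurable A hA) measurable_const)).2 this
  filter_upwards [ae_all_iff.2 h1] with ω hω
  refine le_antisymm (ge_of_tendsto' (x := atTop) ?_ hω) zero_le
  have := ENNReal.tendsto_ofReal (tendsto_one_div_add_atTop_nhds_zero_nat (𝕜 := ℝ))
  simpa using this

theorem IsFrechetSupMeasure.ae_union (hM : IsFrechetSupMeasure α μ P M) {A B : Set S}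
    (hA : MeasurableSet A) (hB : MeasurableSet B) (hAB : Disjoint A B) :
    ∀ᵐ ω ∂P, M (A ∪ B) ω = M A ω ⊔ M B ω := by
  let C : ℕ → Set S := fun n => if n = 0 then A else if n = 1 then B else ∅
  have hC : ∀ n, MeasurableSet (C n) := fun n => by
    simp only [C]; split_ifs <;> simp [hA, hB]
  have hdisj : Pairwise fun i j => Disjoint (C i) (C j) := by
    intro i j hij
    simp only [C]
    split_ifs <;> first | omega | exact hAB | exact hAB.symm | simp
  have hU : (⋃ n, C n) = A ∪ B := by
    ext s
    simp only [mem_iUnion, mem_union]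
    constructor
    · rintro ⟨n, hn⟩
      simp only [C] at hn
      split_ifs at hn
      · exact Or.inl hn
      · exact Or.inr hn
      · exact absurd hn (notMem_empty s)
    · rintro (h | h)
      · exact ⟨0, by simpa [C] using h⟩
      · exact ⟨1, by simpa [C] using h⟩
  filter_upwards [hM.iUnion C hC hdisj, hM.ae_eq_zero .empty measure_empty] with ω h1 h2
  rw [← hU, h1]
  apply le_antisymm
  · refine iSup_le fun n => ?_
    simp only [C]
    split_ifs
    · exact le_sup_left
    · exact le_sup_right
    · rw [h2]; exact zero_le
  · refine sup_le (le_iSup_of_le 0 ?_) (le_iSup_of_le 1 ?_) <;> simp [C]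

theorem IsFrechetSupMeasure.ae_preimage_finset (hM : IsFrechetSupMeasure α μ P M) {β : Type*}
    (p : SimpleFunc S β) (J : Finset β) :
    ∀ᵐ ω ∂P, M (p ⁻¹' J) ω = J.sup fun v => M (p ⁻¹' {v}) ω := by
  classical
  induction J using Finset.cons_induction with
  | empty => simpa using hM.ae_eq_zero .empty measure_empty
  | cons v J hv ih =>
    have hdisj : Disjoint (p ⁻¹' {v}) (p ⁻¹' J) := by
      refine Disjoint.preimage _ ?_
      simpa using hv
    filter_upwards [ih, hM.ae_union (p.measurableSet_preimage {v}) (p.measurableSet_preimage J)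
      hdisj] with ω h1 h2
    rw [Finset.sup_cons, ← h1, ← h2, ← preimage_union, Finset.coe_cons, insert_eq]

/-- The extremal integral may be computed on any finer finite partition; on a common refinement of
two simple functions it becomes visibly max-linear. -/
theorem IsFrechetSupMeasure.ae_integral_map (hM : IsFrechetSupMeasure α μ P M) {β : Type*}
    (p : SimpleFunc S β) (k : β → ℝ≥0) :
    ∀ᵐ ω ∂P, simpleExtremalIntegral M (p.map k) ω =
      p.range.sup fun v => (k v : ℝ≥0∞) * M (p ⁻¹' {v}) ω := by
  classical
  have h1 : ∀ᵐ ω ∂P, ∀ c ∈ (p.map k).range,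
      M (p.map k ⁻¹' {c}) ω = (p.range.filter fun b => k b = c).sup fun v => M (p ⁻¹' {v}) ω := by
    refine (Finset.eventually_all _).2 fun c _ => ?_
    rw [SimpleFunc.map_preimage_singleton]
    convert hM.ae_preimage_finset p (p.range.filter fun b => k b = c)
  filter_upwards [h1] with ω hω
  rw [simpleExtremalIntegral, Finset.sup_congr rfl fun c hc => by rw [hω c hc]]
  rw [SimpleFunc.range_map, Finset.sup_image]
  have hmul : ∀ (c : ℝ≥0∞) (J : Finset β) (x : β → ℝ≥0∞), c * J.sup x = J.sup fun v => c * x v :=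
    fun c J x => Finset.apply_sup_eq_sup_comp_of_linearOrder (fun y => c * y)
      (fun _ _ h => mul_le_mul_right h c) (mul_zero c)
  refine le_antisymm (Finset.sup_le fun v _ => ?_) (Finset.sup_mono_fun fun v hv => ?_)
  · simp only [Function.comp_apply, hmul]
    refine Finset.sup_le fun w hw => ?_
    obtain ⟨hw1, hw2⟩ := Finset.mem_filter.1 hw
    rw [← hw2]
    exact Finset.le_sup (f := fun v => (k v : ℝ≥0∞) * M (p ⁻¹' {v}) ω) hw1
  · simp only [Function.comp_apply]
    gcongr
    exact Finset.le_sup (f := fun v => M (p ⁻¹' {v}) ω) (Finset.mem_filter.2 ⟨hv, rfl⟩)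

theorem IsFrechetSupMeasure.ae_integral_max (hM : IsFrechetSupMeasure α μ P M)
    (φ ψ : SimpleFunc S ℝ≥0) :
    ∀ᵐ ω ∂P, simpleExtremalIntegral M (φ ⊔ ψ) ω =
      simpleExtremalIntegral M φ ω ⊔ simpleExtremalIntegral M ψ ω := by
  filter_upwards [hM.ae_integral_map (φ.pair ψ) Prod.fst, hM.ae_integral_map (φ.pair ψ) Prod.snd,
    hM.ae_integral_map (φ.pair ψ) fun v => v.1 ⊔ v.2] with ω h1 h2 h3
  rw [SimpleFunc.map_fst_pair] at h1
  rw [SimpleFunc.map_snd_pair] at h2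
  have h4 : (φ.pair ψ).map (fun v => v.1 ⊔ v.2) = φ ⊔ ψ := rfl
  rw [← h4, h3, h1, h2, ← Finset.sup_sup]
  refine Finset.sup_congr rfl fun v _ => ?_
  simp only [Pi.sup_apply]
  rw [ENNReal.coe_max]
  exact (max_mul _ _ _)

theorem IsFrechetSupMeasure.ae_integral_smul (hM : IsFrechetSupMeasure α μ P M)
    (φ : SimpleFunc S ℝ≥0) (a : ℝ≥0) :
    ∀ᵐ ω ∂P, simpleExtremalIntegral M (φ.map (a * ·)) ω = a * simpleExtremalIntegral M φ ω := by
  filter_upwards [hM.ae_integral_map φ (a * ·)] with ω h1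
  rw [h1, simpleExtremalIntegral, Finset.apply_sup_eq_sup_comp_of_linearOrder
    (fun y : ℝ≥0∞ => (a : ℝ≥0∞) * y) (fun _ _ h => mul_le_mul_right h _) (mul_zero _)]
  simp [Function.comp_def, mul_assoc]

theorem IsFrechetSupMeasure.ae_integral_sup (hM : IsFrechetSupMeasure α μ P M) {T : Type*}
    (φ : T → SimpleFunc S ℝ≥0) (a : T → ℝ≥0) (J : Finset T) :
    ∀ᵐ ω ∂P, simpleExtremalIntegral M (J.sup fun t => (φ t).map (a t * ·)) ω =
      J.sup fun t => a t * simpleExtremalIntegral M (φ t) ω := by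
  induction J using Finset.cons_induction with
  | empty =>
    refine Eventually.of_forall fun ω => ?_
    simp only [Finset.sup_empty, simpleExtremalIntegral]
    refine le_antisymm (Finset.sup_le fun c hc => ?_) bot_le
    obtain ⟨s, rfl⟩ := SimpleFunc.mem_range.1 hc
    have hs : (⊥ : SimpleFunc S ℝ≥0) s = 0 := rfl
    simp [hs]
  | cons t J ht ih =>
    filter_upwards [ih, hM.ae_integral_smul (φ t) (a t),
      hM.ae_integral_max ((φ t).map (a t * ·)) (J.sup fun t => (φ t).map (a t * ·))] with ω h1 h2 h3
    rw [Finset.sup_cons, Finset.sup_cons, h3, h2, h1]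

theorem IsFrechetSupMeasure.law_mul (hM : IsFrechetSupMeasure α μ P M) (hα : 0 < α) {A : Set S}
    (hA : MeasurableSet A) {v : ℝ≥0} (hv : (v : ℝ≥0∞) ^ α * μ A < ∞) {x : ℝ} (hx : 0 < x) :
    P {ω | v * M A ω ≤ ENNReal.ofReal x} =
      ENNReal.ofReal (Real.exp (-(((v : ℝ≥0∞) ^ α * μ A).toReal * x ^ (-α)))) := by
  rcases eq_or_ne v 0 with rfl | hv0
  -- The value `0` is the only one allowed on a set of infinite measure; there `0 * ∞ = 0` on both
  -- sides.
  · simp [hα]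
  have hvpos : (0 : ℝ) < v := NNReal.coe_pos.2 (pos_iff_ne_zero.2 hv0)
  have hvE : (v : ℝ≥0∞) ≠ 0 := by simpa using hv0
  have hμ : μ A < ∞ := by
    rw [lt_top_iff_ne_top]
    rintro h
    rw [h, ENNReal.mul_top] at hv
    · exact lt_irrefl _ hv
    · simp [ENNReal.rpow_eq_zero_iff, hv0, hα.not_gt]
  have h1 : {ω | v * M A ω ≤ ENNReal.ofReal x} = {ω | M A ω ≤ ENNReal.ofReal (x / v)} := by
    ext ω
    rw [mem_ofPred_eq, mem_ofPred_eq, ENNReal.ofReal_div_of_pos hvpos, ENNReal.ofReal_coe_nnreal,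
      ENNReal.le_div_iff_mul_le (Or.inl hvE) (Or.inl ENNReal.coe_ne_top), mul_comm]
  rw [h1, hM.law_of_lt_top A hA hμ _ (div_pos hx hvpos)]
  congr 3
  rw [ENNReal.toReal_mul, ← ENNReal.toReal_rpow, ENNReal.coe_toReal, Real.div_rpow hx.le hvpos.le,
    Real.rpow_neg hvpos.le, div_inv_eq_mul]
  ring

/-- The level sets are disjoint, so their `M` values are independent; the distribution function of
the maximum is a product and the exponents add up to the integral. -/
theorem IsFrechetSupMeasure.law_integral (hM : IsFrechetSupMeasure α μ P M) (hα : 0 < α)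
    {φ : SimpleFunc S ℝ≥0} (hφ : ⇑φ ∈ Lplus α μ) {x : ℝ} (hx : 0 < x) :
    P {ω | simpleExtremalIntegral M φ ω ≤ ENNReal.ofReal x} =
      ENNReal.ofReal (Real.exp (-((∫⁻ s, (φ s : ℝ≥0∞) ^ α ∂μ).toReal * x ^ (-α)))) := by
  have hsum : ∫⁻ s, (φ s : ℝ≥0∞) ^ α ∂μ =
      ∑ v ∈ φ.range, (v : ℝ≥0∞) ^ α * μ (φ ⁻¹' {v}) := by
    rw [← SimpleFunc.map_lintegral (fun v : ℝ≥0 => (v : ℝ≥0∞) ^ α) φ,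
      ← SimpleFunc.lintegral_eq_lintegral]
    rfl
  have hfin : ∀ v ∈ φ.range, (v : ℝ≥0∞) ^ α * μ (φ ⁻¹' {v}) < ∞ := by
    have := hφ.2
    rw [hsum] at this
    exact ENNReal.sum_lt_top.1 this
  let e := φ.range.equivFin.symm
  have hind := hM.indep _ (fun i => φ ⁻¹' {(e i : ℝ≥0)}) (fun i => φ.measurableSet_preimage _)
    fun i j hij => Disjoint.preimage _ (by
      rw [disjoint_singleton]
      exact fun h => hij (e.injective (Subtype.ext h)))
  have hset : {ω | simpleExtremalIntegral M φ ω ≤ ENNReal.ofReal x} =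
      ⋂ i ∈ Finset.univ, M (φ ⁻¹' {(e i : ℝ≥0)}) ⁻¹'
        {m | ((e i : ℝ≥0) : ℝ≥0∞) * m ≤ ENNReal.ofReal x} := by
    ext ω
    simp only [simpleExtremalIntegral, mem_ofPred_eq, Finset.sup_le_iff, mem_iInter, mem_preimage,
      Finset.mem_univ, forall_true_left]
    exact ⟨fun h i => h _ (e i).2, fun h v hv => by simpa using h (e.symm ⟨v, hv⟩)⟩
  rw [hset, hind.measure_inter_preimage_eq_mul Finset.univ
    (sets := fun i => {m | ((e i : ℝ≥0) : ℝ≥0∞) * m ≤ ENNReal.ofReal x}) fun i _ =>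
      measurableSet_le (measurable_id.const_mul _) measurable_const]
  have hlaw : ∀ i, P (M (φ ⁻¹' {(e i : ℝ≥0)}) ⁻¹'
      {m | ((e i : ℝ≥0) : ℝ≥0∞) * m ≤ ENNReal.ofReal x}) = ENNReal.ofReal (Real.exp
        (-((((e i : ℝ≥0) : ℝ≥0∞) ^ α * μ (φ ⁻¹' {(e i : ℝ≥0)})).toReal * x ^ (-α)))) := fun i =>
    hM.law_mul hα (φ.measurableSet_preimage _) (hfin _ (e i).2) hx
  rw [Finset.prod_congr rfl fun i _ => hlaw i,
    ← ENNReal.ofReal_prod_of_nonneg fun i _ => (Real.exp_pos _).le, ← Real.exp_sum, hsum,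
    ENNReal.toReal_sum fun v hv => (hfin v hv).ne, Finset.sum_neg_distrib, ← Finset.sum_mul]
  congr 4
  rw [← Finset.sum_coe_sort φ.range]
  exact e.sum_comp fun v : φ.range => (((v : ℝ≥0) : ℝ≥0∞) ^ α * μ (φ ⁻¹' {(v : ℝ≥0)})).toReal

theorem IsFrechetSupMeasure.ae_integral_lt_top (hM : IsFrechetSupMeasure α μ P M) (hα : 0 < α)
    {φ : SimpleFunc S ℝ≥0} (hφ : ⇑φ ∈ Lplus α μ) :
    P {ω | simpleExtremalIntegral M φ ω = ∞} = 0 := by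
  have hmeas : Measurable fun ω => simpleExtremalIntegral M φ ω := by
    unfold simpleExtremalIntegral
    induction φ.range using Finset.cons_induction with
    | empty => simp
    | cons v J hv ih =>
      simp only [Finset.sup_cons]
      exact ((hM.measurable _ (φ.measurableSet_preimage _)).const_mul _).sup ih
  set c := (∫⁻ s, (φ s : ℝ≥0∞) ^ α ∂μ).toReal
  have hle : ∀ n : ℕ, P {ω | simpleExtremalIntegral M φ ω = ∞} ≤
      1 - ENNReal.ofReal (Real.exp (-(c * ((n : ℝ) + 1) ^ (-α)))) := by
    intro n
    rw [← hM.law_integral hα hφ (by positivity : (0 : ℝ) < (n : ℝ) + 1),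
      ← prob_compl_eq_one_sub (measurableSet_le hmeas measurable_const)]
    refine measure_mono fun ω hω => ?_
    simp only [mem_compl_iff, mem_ofPred_eq] at hω ⊢
    simp [hω]
  refine le_antisymm (ge_of_tendsto' (x := atTop) ?_ hle) zero_le
  have h1 : Tendsto (fun n : ℕ => ((n : ℝ) + 1) ^ (-α)) atTop (𝓝 0) :=
    (tendsto_rpow_neg_atTop hα).comp
      (tendsto_atTop_add_const_right _ _ tendsto_natCast_atTop_atTop)
  have h2 : Tendsto (fun n : ℕ => ENNReal.ofReal (Real.exp (-(c * ((n : ℝ) + 1) ^ (-α))))) atTop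
      (𝓝 (ENNReal.ofReal (Real.exp (-(c * 0))))) :=
    ENNReal.tendsto_ofReal ((Real.continuous_exp.tendsto _).comp (h1.const_mul c).neg)
  have h3 := ENNReal.Tendsto.sub (tendsto_const_nhds (x := (1 : ℝ≥0∞))) h2 (Or.inl ENNReal.one_ne_top)
  simpa using h3

theorem rhoDist_sup_le {T : Type*} (hα : 0 < α) {φ f : T → S → ℝ≥0}
    (hφ : ∀ t, Measurable (φ t)) (hf : ∀ t, Measurable (f t)) (J : Finset T) (a : T → ℝ≥0) :
    rhoDist α μ (fun s => J.sup fun t => a t * φ t s) (fun s => J.sup fun t => a t * f t s) ≤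
      ∑ t ∈ J, (a t ^ α : ℝ≥0) * rhoDist α μ (φ t) (f t) := by
  induction J using Finset.cons_induction with
  | empty => simp [rhoDist]
  | cons t J ht ih =>
    simp only [Finset.sup_cons, Finset.sum_cons]
    have h1 := rhoDist_max_le (μ₁ := μ) hα (hf t) (hφ t) (measurable_finset_sup_mul hf J a)
      (measurable_finset_sup_mul hφ J a) (a t) 1
    simp only [one_mul, NNReal.one_rpow, ENNReal.coe_one] at h1
    exact h1.trans (by gcongr)

theorem lintegral_rpow_le_add_rhoDist (hα : 0 < α) {φ ψ : S → ℝ≥0} (hφ : Measurable φ) :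
    ∫⁻ s, (ψ s : ℝ≥0∞) ^ α ∂μ ≤ ∫⁻ s, (φ s : ℝ≥0∞) ^ α ∂μ + rhoDist α μ ψ φ := by
  rw [rhoDist, ← lintegral_add_left (hφ.coe_nnreal_ennreal.pow_const α)]
  refine lintegral_mono fun s => ?_
  simp only [← ENNReal.coe_rpow_of_nonneg _ hα.le]
  exact nnreal_coe_le_add_edist _ _

theorem rhoDist_comm (φ ψ : S → ℝ≥0) : rhoDist α μ φ ψ = rhoDist α μ ψ φ := by
  simp only [rhoDist, edist_comm]

theorem tendsto_lintegral_rpow (hα : 0 < α) {φ : ℕ → S → ℝ≥0} {f : S → ℝ≥0}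
    (hφ : ∀ n, Measurable (φ n)) (hf : f ∈ Lplus α μ)
    (h : Tendsto (fun n => rhoDist α μ (φ n) f) atTop (𝓝 0)) :
    Tendsto (fun n => ∫⁻ s, (φ n s : ℝ≥0∞) ^ α ∂μ) atTop (𝓝 (∫⁻ s, (f s : ℝ≥0∞) ^ α ∂μ)) := by
  have h1 := ENNReal.Tendsto.sub (tendsto_const_nhds (x := ∫⁻ s, (f s : ℝ≥0∞) ^ α ∂μ)) h
    (Or.inl hf.2.ne)
  have h2 := (tendsto_const_nhds (x := ∫⁻ s, (f s : ℝ≥0∞) ^ α ∂μ)).add h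
  rw [tsub_zero] at h1
  rw [add_zero] at h2
  refine tendsto_of_tendsto_of_tendsto_of_le_of_le h1 h2 (fun n => ?_) fun n => ?_
  · rw [tsub_le_iff_right, rhoDist_comm]
    exact lintegral_rpow_le_add_rhoDist hα (hφ n)
  · exact lintegral_rpow_le_add_rhoDist hα hf.1

theorem sup_mem_Lplus {T : Type*} (hα : 0 < α) {f : T → S → ℝ≥0} (hf : ∀ t, f t ∈ Lplus α μ)
    (J : Finset T) (a : T → ℝ≥0) : (fun s => J.sup fun t => a t * f t s) ∈ Lplus α μ := by
  refine ⟨measurable_finset_sup_mul (fun t => (hf t).1) J a, ?_⟩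
  simp only [← ENNReal.coe_rpow_of_nonneg _ hα.le, sup_mul_rpow hα]
  exact (lintegral_sup_ne_top (F := fun t s => f t s ^ α) (fun t => (hf t).1.pow_const _)
    (fun t => by simpa [ENNReal.coe_rpow_of_nonneg _ hα.le] using (hf t).2.ne) J _).lt_top

/-- The joint distribution function of finitely many extremal integrals. -/
theorem IsFrechetSupMeasure.law_extremalIntegral (hM : IsFrechetSupMeasure α μ P M) (hα : 0 < α)
    {T : Type*} {f : T → S → ℝ≥0} (hf : ∀ t, f t ∈ Lplus α μ) {ξ : T → Ω → ℝ≥0∞}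
    (hξ : ∀ t, IsExtremalIntegral α μ P M (f t) (ξ t)) (J : Finset T) (a : T → ℝ≥0) :
    P {ω | ∀ t ∈ J, (a t : ℝ) * (ξ t ω).toReal ≤ 1} = ENNReal.ofReal (Real.exp
      (-(∫⁻ s, ((J.sup fun t => a t * f t s : ℝ≥0) : ℝ≥0∞) ^ α ∂μ).toReal)) := by
  choose φ hφ hρ hlim using hξ
  set c := (∫⁻ s, ((J.sup fun t => a t * f t s : ℝ≥0) : ℝ≥0∞) ^ α ∂μ).toReal
  let Z : ℕ → SimpleFunc S ℝ≥0 := fun n => J.sup fun t => (φ t n).map (a t * ·)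
  have hZ : ∀ n, ⇑(Z n) = fun s => J.sup fun t => a t * φ t n s := fun n => by
    ext1 s
    simp [Z, SimpleFunc.finset_sup_apply]
  have hZL : ∀ n, ⇑(Z n) ∈ Lplus α μ := fun n => by
    rw [hZ]
    exact sup_mem_Lplus hα (fun t => hφ t n) J a
  have hcn : Tendsto (fun n => (∫⁻ s, (Z n s : ℝ≥0∞) ^ α ∂μ).toReal) atTop (𝓝 c) := by
    refine (ENNReal.tendsto_toReal (sup_mem_Lplus hα hf J a).2.ne).comp
      (tendsto_lintegral_rpow hα (fun n => (hZL n).1) (sup_mem_Lplus hα hf J a) ?_)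
    refine tendsto_of_tendsto_of_tendsto_of_le_of_le (tendsto_const_nhds (x := 0))
      (h := fun n => ∑ t ∈ J, (a t ^ α : ℝ≥0) * rhoDist α μ (φ t n) (f t)) ?_
      (fun n => zero_le) (fun n => ?_)
    · have : Tendsto (fun n => ∑ t ∈ J, ((a t ^ α : ℝ≥0) : ℝ≥0∞) * rhoDist α μ (φ t n) (f t)) atTop
          (𝓝 (∑ t ∈ J, ((a t ^ α : ℝ≥0) : ℝ≥0∞) * 0)) :=
        tendsto_finsetSum _ fun t _ =>
          ENNReal.Tendsto.const_mul (hρ t) (Or.inr ENNReal.coe_ne_top)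
      simpa using this
    · simp only [hZ]
      exact rhoDist_sup_le hα (fun t => (hφ t n).1) (fun t => (hf t).1) J a
  have hlawn : ∀ n (x : ℝ), 0 < x →
      P {ω | ∀ t ∈ J, a t * simpleExtremalIntegral M (φ t n) ω ≤ ENNReal.ofReal x} =
        ENNReal.ofReal (Real.exp (-((∫⁻ s, (Z n s : ℝ≥0∞) ^ α ∂μ).toReal * x ^ (-α)))) := by
    intro n x hx
    rw [← hM.law_integral hα (hZL n) hx]
    refine measure_congr (eventuallyEq_set.2 ?_)
    filter_upwards [hM.ae_integral_sup (fun t => φ t n) a J] with ω hω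
    simp only [Z, hω, Finset.sup_le_iff]
  have hlawlim : ∀ x : ℝ, Tendsto (fun n => ENNReal.ofReal (Real.exp
      (-((∫⁻ s, (Z n s : ℝ≥0∞) ^ α ∂μ).toReal * x ^ (-α))))) atTop
      (𝓝 (ENNReal.ofReal (Real.exp (-(c * x ^ (-α)))))) := fun x =>
    ENNReal.tendsto_ofReal ((Real.continuous_exp.tendsto _).comp (hcn.mul_const _).neg)
  -- The exceptional event: some approximating integral with index in `J` is at least `δ` away from
  -- its limit. Off it, the thresholds shift by a controlled amount.
  let E : ℝ≥0∞ → ℕ → Set Ω := fun δ n =>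
    ⋃ t ∈ J, {ω | δ ≤ edist (simpleExtremalIntegral M (φ t n) ω) (ξ t ω)}
  have hE : ∀ δ, 0 < δ → Tendsto (fun n => P (E δ n)) atTop (𝓝 0) := by
    intro δ hδ
    refine tendsto_of_tendsto_of_tendsto_of_le_of_le (tendsto_const_nhds (x := 0))
      (h := fun n => ∑ t ∈ J, P {ω | δ ≤ edist (simpleExtremalIntegral M (φ t n) ω) (ξ t ω)}) ?_
      (fun n => zero_le) (fun n => measure_biUnion_finset_le _ _)
    simpa using tendsto_finsetSum J fun t _ => hlim t δ hδ
  -- Needed because `toReal` sends `∞` to `0`. The simple integrals are a.s. finite, and a finite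
  -- value lies at distance `∞` from `∞`.
  have hξfin : ∀ t, ∀ᵐ ω ∂P, ξ t ω ≠ ∞ := by
    intro t
    refine le_antisymm (ge_of_tendsto' (hlim t 1 one_pos) fun n => ?_) zero_le
    rw [← zero_add (P {ω | 1 ≤ edist (simpleExtremalIntegral M (φ t n) ω) (ξ t ω)}),
      ← hM.ae_integral_lt_top hα (hφ t n)]
    refine (measure_mono fun ω hω => ?_).trans (measure_union_le _ _)
    have hω' : ξ t ω = ∞ := by simpa using hω
    by_cases h : simpleExtremalIntegral M (φ t n) ω = ∞
    · exact Or.inl h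
    · refine Or.inr ?_
      rw [mem_ofPred_eq, (ENNReal.edist_eq_top_iff _ _).2 ⟨by rwa [hω'], Or.inr hω'⟩]
      exact le_top
  have hset : P {ω | ∀ t ∈ J, (a t : ℝ) * (ξ t ω).toReal ≤ 1} =
      P {ω | ∀ t ∈ J, a t * ξ t ω ≤ ENNReal.ofReal 1} := by
    refine measure_congr (eventuallyEq_set.2 ?_)
    filter_upwards [(Finset.eventually_all J).2 fun t _ => hξfin t] with ω hω
    refine forall₂_congr fun t ht => ?_
    rw [← ENNReal.toReal_le_toReal (ENNReal.mul_ne_top ENNReal.coe_ne_top (hω t ht))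
      ENNReal.ofReal_ne_top]
    simp
  have hperturb : ∀ ε : ℝ, 0 < ε → ∃ δ : ℝ≥0∞, 0 < δ ∧ ∀ t ∈ J, a t * δ ≤ ENNReal.ofReal ε := by
    intro ε hε
    refine ⟨ENNReal.ofReal ε / (∑ t ∈ J, (a t : ℝ≥0∞) + 1), ENNReal.div_pos (by simpa using hε)
      (by simp [ENNReal.sum_eq_top]), fun t ht => ?_⟩
    rw [← mul_div_assoc, mul_comm, mul_div_assoc]
    refine mul_le_of_le_one_right zero_le (ENNReal.div_le_of_le_mul ?_)
    rw [one_mul]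
    exact (Finset.single_le_sum (f := fun t => (a t : ℝ≥0∞)) (fun _ _ => zero_le) ht).trans
      le_self_add
  have hmul : ∀ (t : T) (x y δ ε r : ℝ≥0∞), edist x y < δ → a t * δ ≤ ε → a t * y ≤ r →
      a t * x ≤ r + ε := by
    intro t x y δ ε r h1 h2 h3
    calc a t * x ≤ a t * (y + δ) := by
          gcongr; exact (ennreal_le_add_edist x y).trans (by gcongr)
      _ = a t * y + a t * δ := mul_add _ _ _
      _ ≤ r + ε := add_le_add h3 h2
  -- Convergence in probability costs a margin, so the threshold `1` is compared with thresholds `x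
  -- > 1` here and `x < 1` below; continuity of the Fréchet distribution function at `1` closes the
  -- gap.
  have hupper : ∀ x : ℝ, 1 < x → P {ω | ∀ t ∈ J, a t * ξ t ω ≤ ENNReal.ofReal 1} ≤
      ENNReal.ofReal (Real.exp (-(c * x ^ (-α)))) := by
    intro x hx
    obtain ⟨δ, hδ, hδJ⟩ := hperturb (x - 1) (by linarith)
    have hl := (hlawlim x).add (hE δ hδ)
    rw [add_zero] at hl
    refine ge_of_tendsto' hl fun n => ?_
    rw [← hlawn n x (by linarith)]
    refine (measure_mono fun ω hω => ?_).trans (measure_union_le _ _)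
    by_cases hωE : ω ∈ E δ n
    · exact Or.inr hωE
    · refine Or.inl fun t ht => ?_
      simp only [E, mem_iUnion, mem_ofPred_eq, not_exists, not_le] at hωE
      refine (hmul t _ _ δ _ _ (hωE t ht) (hδJ t ht) (hω t ht)).trans ?_
      rw [← ENNReal.ofReal_add zero_le_one (by linarith)]
      simp
  have hlower : ∀ x : ℝ, 0 < x → x < 1 → ENNReal.ofReal (Real.exp (-(c * x ^ (-α)))) ≤
      P {ω | ∀ t ∈ J, a t * ξ t ω ≤ ENNReal.ofReal 1} := by
    intro x hx hx1
    obtain ⟨δ, hδ, hδJ⟩ := hperturb (1 - x) (by linarith)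
    have hl := (tendsto_const_nhds
      (x := P {ω | ∀ t ∈ J, a t * ξ t ω ≤ ENNReal.ofReal 1})).add (hE δ hδ)
    rw [add_zero] at hl
    refine le_of_tendsto_of_tendsto' (hlawlim x) hl fun n => ?_
    rw [← hlawn n x hx]
    refine (measure_mono fun ω hω => ?_).trans (measure_union_le _ _)
    by_cases hωE : ω ∈ E δ n
    · exact Or.inr hωE
    · refine Or.inl fun t ht => ?_
      simp only [E, mem_iUnion, mem_ofPred_eq, not_exists, not_le] at hωE
      have h1 := hωE t ht
      rw [WeakPseudoEMetricSpace.edist_comm] at h1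
      refine (hmul t _ _ δ _ _ h1 (hδJ t ht) (hω t ht)).trans ?_
      rw [← ENNReal.ofReal_add hx.le (by linarith)]
      simp
  have hcont : Tendsto (fun x : ℝ => ENNReal.ofReal (Real.exp (-(c * x ^ (-α))))) (𝓝 1)
      (𝓝 (ENNReal.ofReal (Real.exp (-c)))) := by
    have h1 : Tendsto (fun x : ℝ => x ^ (-α)) (𝓝 1) (𝓝 1) := by
      simpa using (Real.continuousAt_rpow_const 1 (-α) (Or.inl one_ne_zero)).tendsto
    have h2 := ENNReal.tendsto_ofReal ((Real.continuous_exp.tendsto _).comp (h1.const_mul c).neg)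
    simpa [Function.comp_def] using h2
  rw [hset]
  apply le_antisymm
  · refine ge_of_tendsto (hcont.mono_left (nhdsWithin_le_nhds (s := Ioi 1))) ?_
    filter_upwards [self_mem_nhdsWithin] with x hx using hupper x hx
  · refine le_of_tendsto (hcont.mono_left (nhdsWithin_le_nhds (s := Iio 1))) ?_
    filter_upwards [Ioo_mem_nhdsLT (zero_lt_one (α := ℝ))] with x hx using hlower x hx.1 hx.2

end SupMeasure

/-! ### From the process to equality of norms. -/

section SpectralRep

variable {S S₁ Ω T : Type*} [MeasurableSpace S] [MeasurableSpace S₁] [MeasurableSpace Ω] {α : ℝ}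
  {P : Measure Ω} {X : T → Ω → ℝ} {μ : Measure S} {μ₁ : Measure S₁} {f : T → S₁ → ℝ≥0}
  {g : T → S → ℝ≥0}

theorem IsSpectralRep.law (hα : 0 < α) (hg : IsSpectralRep α P X μ g) (J : Finset T)
    (a : T → ℝ≥0) : P {ω | ∀ t ∈ J, (a t : ℝ) * X t ω ≤ 1} = ENNReal.ofReal (Real.exp
      (-(∫⁻ s, ((J.sup fun t => a t * g t s : ℝ≥0) : ℝ≥0∞) ^ α ∂μ).toReal)) := by
  obtain ⟨hgL, Ω', _, P', M, ξ, _, hM, hξ, hid⟩ := hg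
  rw [← hM.law_extremalIntegral hα hgL hξ J a]
  have hmeas : MeasurableSet {x : J → ℝ | ∀ t : J, (a t : ℝ) * x t ≤ 1} := by
    simp only [ofPred_forall]
    exact .iInter fun t => measurableSet_le ((measurable_pi_apply t).const_mul _) measurable_const
  simpa using (hid J).measure_mem_eq hmeas

theorem IsSpectralRep.sameNorms (hα : 0 < α) (hf : IsSpectralRep α P X μ₁ f)
    (hg : IsSpectralRep α P X μ g) : SameNorms α μ₁ μ f g where
  left_mem := hf.1
  right_mem := hg.1
  norms J a _ _ := by
    have h := (hf.law hα J a).symm.trans (hg.law hα J a)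
    rw [ENNReal.ofReal_eq_ofReal_iff (Real.exp_pos _).le (Real.exp_pos _).le, Real.exp_eq_exp,
      neg_inj] at h
    exact (ENNReal.toReal_eq_toReal_iff' (sup_mem_Lplus hα hf.1 J a).2.ne
      (sup_mem_Lplus hα hg.1 J a).2.ne).1 h

/-- Over an empty space all norms vanish and `P(X_t ≤ 1) = 1`, whereas a Fréchet law with positive
scale gives `exp(-σ^α) < 1`. The decoder needs a point to map to. -/
theorem IsSpectralRep.nonempty (hα : 0 < α) (hX : IsFrechetProcess α P X)
    (hf : IsSpectralRep α P X μ₁ f) (t : T) : Nonempty S₁ := by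
  by_contra hempty
  rw [not_nonempty_iff] at hempty
  obtain ⟨σ, hσ, hlaw⟩ := hX.2 {t} (by simp) 1 (by simp)
  have h1 := hlaw 1 one_pos
  have h2 := hf.law hα {t} 1
  simp only [Finset.sup'_singleton, Pi.one_apply, one_mul] at h1
  simp only [Finset.mem_singleton, forall_eq, Pi.one_apply, NNReal.coe_one, one_mul,
    lintegral_of_isEmpty, ENNReal.toReal_zero, neg_zero, Real.exp_zero] at h2
  rw [h1, ENNReal.ofReal_eq_ofReal_iff (Real.exp_pos _).le zero_le_one, Real.exp_eq_one_iff,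
    Real.one_rpow, mul_one, neg_eq_zero] at h2
  exact (Real.rpow_pos_of_pos hσ α).ne' h2

end SpectralRep

end MaxStable

end

theorem theorem4p2 {T : Type*} {Ω : Type*} [MeasurableSpace Ω] {S : Type*} [MeasurableSpace S]
    [StandardBorelSpace S] (α : ℝ) (hα : 0 < α)
    (P : Measure Ω) [IsProbabilityMeasure P] (X : T → Ω → ℝ)
    (hX : MaxStable.IsFrechetProcess α P X)
    (I : Fin 2) (N : ℕ∞) (f : T → MaxStable.stdSupport I N → ℝ≥0)
    (hf : MaxStable.IsSpectralRep α P X (MaxStable.stdMeasure I N) f)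
    (hmin : MaxStable.IsMinimal α (MaxStable.stdMeasure I N) f)
    (μ : Measure S) [SigmaFinite μ] (g : T → S → ℝ≥0)
    (hg : MaxStable.IsSpectralRep α P X μ g) :
    -- the relating isometry exists and is unique
    (∃ U, MaxStable.IsRelatingIsometry α (MaxStable.stdMeasure I N) μ f g U ∧
      ∀ U', MaxStable.IsRelatingIsometry α (MaxStable.stdMeasure I N) μ f g U' →
        ∀ φ ∈ MaxStable.closedMaxSpan α (MaxStable.stdMeasure I N) f, U' φ =ᵐ[μ] U φ) ∧
    -- the support of the second representation exists
    (∃ A : Set S, MeasurableSet A ∧ MaxStable.IsSupport α μ g A) ∧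
    ∀ U, MaxStable.IsRelatingIsometry α (MaxStable.stdMeasure I N) μ f g U →
      -- unique extension of the relating isometry
      ∃ V, MaxStable.IsIsometryExtension α (MaxStable.stdMeasure I N) μ f U V ∧
        (∀ V', MaxStable.IsIsometryExtension α (MaxStable.stdMeasure I N) μ f U V' →
          ∀ φ ∈ MaxStable.Lplus α (MaxStable.stdMeasure I N), V' φ =ᵐ[μ] V φ) ∧
        -- point representation on the support, and uniqueness of the point map
        ∀ A : Set S, MeasurableSet A → MaxStable.IsSupport α μ g A →
          ∃ (Φ : S → MaxStable.stdSupport I N) (h : S → ℝ≥0),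
            MaxStable.IsPointRep α (MaxStable.stdMeasure I N) μ f g A Φ h ∧
            SurjOn Φ A univ ∧
            (∀ φ ∈ MaxStable.Lplus α (MaxStable.stdMeasure I N),
              V φ =ᵐ[μ] A.indicator fun s => h s * φ (Φ s)) ∧
            ∀ Φ' h', MaxStable.IsPointRep α (MaxStable.stdMeasure I N) μ f g A Φ' h' →
              Φ' =ᵐ[μ.restrict A] Φ := by
  -- A function in the closed span has an approximating combination over a nonempty index set, which
  -- yields an index `t`.
  obtain ⟨f₀, hf₀, -⟩ := hmin.support
  obtain ⟨_, ⟨J, ⟨t, -⟩, -⟩, -⟩ := hf₀.2 1 one_pos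
  have : Nonempty (MaxStable.stdSupport I N) := hf.nonempty hα hX t
  exact MaxStable.relatingIsometry_of_sameNorms hα hmin (hf.sameNorms hα hg)
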